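/- **Conventions.** Use the ordered alphabets $\ell<c<r$ (unimodal) and $L<A<M<B<R<C<U$ (bimodal data use $L,A,M,B,R$ only), with signs $\epsilon(\ell)=\epsilon(L)=\epsilon(R)=1$, $\epsilon(r)=\epsilon(M)=\epsilon(U)=-1$, $\epsilon(c)=\epsilon(A)=\epsilon(B)=\epsilon(C)=0$. Sequences $S=S_0S_1\dots$ are ordered by $S<T$ iff for some $j$: $S_i=T_i$ for all $i<j$ and $\big(\prod_{i<j}\epsilon(S_i)\big)S_j<\big(\prod_{i<j}\epsilon(S_i)\big)T_j$ (a factor $-1$ reverses the order of symbols, a factor $0$ makes them equal). $\sigma$ is the shift, $w^\infty$ the periodic repetition of a word $w$, and a word is called odd or even according to its number of letters $M$. The word $\overline P$ arises from $P$ by exchanging $L$ and $R$. *Transition matrices.* Given the turning symbols and their kneading sequences $K_c$, the partition points are all $\sigma^n(cK_c)$, $n\ge 0$; ordered as $z_0<\dots<z_N$ they bound $N$ intervals, and the transition matrix is the $N\times N$ matrix over $\{0,1\}$ with $(i,j)$ entry $1$ iff $[z_j,z_{j+1}]$ lies between $\sigma z_i$ and $\sigma z_{i+1}$. *First factors.*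 $\mathcal D$ is the set of symmetric data $V=(PA,\overline PB)$ ("pair", $K_A=(PA)^\infty$, $K_B=(\overline PB)^\infty$) or $V=PB\overline PA$ ("doubly stable", $K_A=(PB\overline PA)^\infty$, $K_B=(\overline PAPB)^\infty$), with $P=P_1\dots P_{p-1}$, $P_i\in\{L,M,R\}$, $p\ge1$, such that $K_A,K_B$ are the itineraries of the images of the turning points $c_1,c_2$ of some continuous bimodal interval map (strictly increasing, decreasing, increasing). $A_V$ is the transition matrix of $(K_A,K_B)$. *Second factors.* $\mathcal U$ is the set of words $X=x_1\dots x_{k-1}c$, $k\ge2$, $x_i\in\{\ell,r\}$, such that $X^\infty$ is the kneading sequence of some continuous unimodal interval map (increasing, then decreasing); $A_X$ is its transition matrix. Each $X\in\mathcal U$ gives two second factors $W\in\mathcal G$: (1) the pair $(X,X)$, with $A_W=(A_X,A_X)$; (2) for $k$ odd the word obtained from $XX$, and for $k$ even the pair of words obtained from $(X,\sigma X)$ ($\sigma X=x_2\dots x_{k-1}cx_1$), by grouping letters in twos and translating $\ell\ell\to L$, $\ell c\to A$, $\ell r\to M$, $cr\to B$, $rr\to R$, $rc\to C$, $r\ell\to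 U$. In case (2), $A_W$ is the transition matrix of the trimodal data with turning symbols $A,B,C$: for $k$ odd, $K_A=K_C=W^\infty$ and $K_B$ is the part of $W^\infty$ after its first $B$; for $k$ even and $W=(u,v)$, $K_A=K_C=u^\infty$ and $K_B=v^\infty$. *Star product.* For $V=(PA,\overline PB)$ and $W=(X,X)$, $V\star W=(Pa(x_1)\dots Pa(x_{k-1})PA,\ \overline Pb(x_1)\dots\overline Pb(x_{k-1})\overline PB)$, where $a(r)=b(r)=M$, $a(\ell)=L$, $b(\ell)=R$ if $P$ is even and $a(\ell)=b(\ell)=M$, $a(r)=L$, $b(r)=R$ if $P$ is odd. For $V=PB\overline PA$ and $W$ as in (2), let $(\beta(Z),\alpha(Z))$, for $Z=L,A,M,B,R,C,U$, be $(M,M),(M,A),(M,L),(B,L),(R,L),(R,A),(R,M)$ if $P$ is even and $(R,L),(R,A),(R,M),(B,M),(M,M),(M,A),(M,L)$ if $P$ is odd. Put $P\star Z_1\dots Z_n=P\beta(Z_1)\overline P\alpha(Z_1)\dots P\beta(Z_n)\overline P\alpha(Z_n)$. If $k$ is odd, $V\star W=P\star W$ (doubly stable data). If $k$ is even and $W=(u,\,Y_1\dots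 Y_{n-1}B)$, then $V\star W$ is the pair with first word $P\star u$ and second word obtained from $\beta(B)\overline P\alpha(B)P\,\beta(Y_1)\overline P\alpha(Y_1)P\dots\beta(Y_{n-1})\overline P\alpha(Y_{n-1})P$ by moving its first letter $\beta(B)=B$ to the end. $A_{V\star W}$ is the transition matrix of the resulting bimodal data (for $k$ odd, $K_B$ starts just after the letter $B$). **Theorem 2.** There is a matrix product $\otimes$, i.e. an operation depending only on the matrices $A_V$ and $A_W$, such that for all $V\in\mathcal D$ and $W\in\mathcal G$ for which $V\star W$ is defined $$A_{V\star W}=A_V\otimes A_W .$$ Here $A_V$ is $(2p-1)$-square, $A_{V\star W}$ is $(2pk-1)$-square, and $A_V\otimes A_W$ is the following block matrix, whose block pattern is determined by $A_V$ alone and whose inner blocks are determined by $A_W$ alone. The matrix $A_V$ determines the map $\nu$ on $\{0,\dots,2p-1\}$ given by $\sigma z_i=z_{\nu(i)}$ on the partition points of $V$, the first symbol $s_i$ of each $z_i$, and a sign: "reversed" if $V$ is a pair with $P$ odd or doubly stable with $P$ even, "direct" otherwise. The matrix $A_W$ determines the $(k-1)$-square matrix $\mathsf B=A_X$. The $2pk-1$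 indices are arranged as $2p$ groups of $k-1$ inner indices, group $i$ and group $i+1$ being separated by one outer index $i$ ($0\le i\le 2p-2$). Then: 1. The (outer, outer) entries form the matrix $A_V$; the (inner, outer) entries are $0$. 2. The (group $i$, group $j$) block is $0$ unless $j=\nu(i)$. For $j=\nu(i)$ it is the identity if $s_i\in\{L,R\}$, the anti-identity if $s_i=M$; if $s_i=A$ it is $\mathsf B$, with rows in reverse order in the reversed case; if $s_i=B$ it is $\mathsf B$ with columns in reverse order, and rows in reverse order too in the direct case. 3. In outer row $i$, let $a$ and $b$ be the entries in the outer columns just before and just after group $j$ (an absent one counts as $0$). If $a=b$, all entries in the columns of group $j$ equal $a$. If $a\ne b$, they are $0$, except for the entries needed for continuity: let $i'=i$ if $j=\nu(i)$, and $i'=i+1$ if $j=\nu(i+1)$. If $s_{i'}=A$ and either $i'=i$ in the reversed case or $i'=i+1$ in the direct case, then the entry in the $t$-th column of group $j$ is $1$ whenever the $t$-th column of $\mathsf B$ contains exactly one $1$. If $s_{i'}=B$ and either $i'=i$ in the direct case or $i'=i+1$ in the reversed case, the same holds with the columns of $\mathsf B$ counted from the right. -/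

import Mathlib

namespace SymBimodal

/-! ### Symbols, itineraries, the order on symbolic sequences -/

/-- Symbols of unimodal maps: left lap, turning point, right lap. -/
inductive USym
  | l | c | r
  deriving DecidableEq

/-- Symbols, in increasing order. Bimodal maps use `L, A, M, B, R`;
trimodal data use all seven; `A`, `B`, `C` are the turning points. -/
inductive Sym
  | L | A | M | B | R | C | U
  deriving DecidableEq

/-- Position of a symbol on the line, and its sign: `1` on increasing laps, `-1` on decreasing
laps, `0` at turning points. -/
class LapAlphabet (α : Type) where
  rank : α → ℤ
  eps : α → ℤ

instance : LapAlphabet USym where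
  rank
    | .l => 0 | .c => 1 | .r => 2
  eps
    | .l => 1 | .c => 0 | .r => -1

instance : LapAlphabet Sym where
  rank
    | .L => 0 | .A => 1 | .M => 2 | .B => 3 | .R => 4 | .C => 5 | .U => 6
  eps
    | .L => 1 | .A => 0 | .M => -1 | .B => 0 | .R => 1 | .C => 0 | .U => -1

section Sequences

variable {α : Type}

/-- The shift. -/
def shift (S : ℕ → α) : ℕ → α := fun n => S (n + 1)

/-- The sequence `a S₀ S₁ S₂ …`. -/
def consSeq (a : α) (S : ℕ → α) : ℕ → α
  | 0 => a
  | n + 1 => S n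

/-- The periodic sequence `w w w …` (constant `d` if `w` is empty). -/
def periodic (d : α) (w : List α) : ℕ → α := fun n => w.getD (n % w.length) d

/-- The strict order on sequences: lexicographic order of `θ_j = ε(S_0) ⋯ ε(S_{j-1}) S_j`. -/
def SeqLT [LapAlphabet α] (S T : ℕ → α) : Prop :=
  ∃ j, (∀ i < j, S i = T i) ∧
    (∏ i ∈ Finset.range j, LapAlphabet.eps (S i)) * LapAlphabet.rank (S j) <
      (∏ i ∈ Finset.range j, LapAlphabet.eps (S i)) * LapAlphabet.rank (T j)

/-- Kneading data: the list of all turning points `c` with their kneading sequences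
(the itinerary of the image of `c`). -/
abbrev KneadingData (α : Type) := List (α × (ℕ → α))

/-- The points of the Markov partition, coded by their itineraries: the turning points and all
their iterates. -/
def points (D : KneadingData α) : Set (ℕ → α) :=
  {z | ∃ cK ∈ D, ∃ n, z = shift^[n] (consSeq cK.1 cK.2)}

/-- The position of `z` among the partition points, counted from `0`. -/
noncomputable def pos [LapAlphabet α] (D : KneadingData α) (z : ℕ → α) : ℕ :=
  {y ∈ points D | SeqLT y z}.ncard

/-- Interval `i` lies between the consecutive partition points of positions `i` and `i + 1`. Both
endpoints are in one closed lap, so its image is the interval between the images of its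
endpoints; `Covers D i j` says that this image contains interval `j`. -/
def Covers [LapAlphabet α] (D : KneadingData α) (i j : ℕ) : Prop :=
  ∃ z ∈ points D, ∃ z' ∈ points D, pos D z = i ∧ pos D z' = i + 1 ∧
    min (pos D (shift z)) (pos D (shift z')) ≤ j ∧
    j < max (pos D (shift z)) (pos D (shift z'))

end Sequences

/-- Square matrices of arbitrary size. -/
abbrev SqMat := Σ n : ℕ, Matrix (Fin n) (Fin n) ℕ

open Classical in
/-- The Markov transition matrix of kneading data. -/
noncomputable def markov {α : Type} [LapAlphabet α] (D : KneadingData α) : SqMat :=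
  ⟨(points D).ncard - 1, Matrix.of fun i j => if Covers D i j then 1 else 0⟩

/-! ### Unimodal kneading sequences -/

/-- Unimodal maps of `[c₀, c₂]` with maximum at `c₁`. -/
structure IsUnimodalMap (f : ℝ → ℝ) (c₀ c₁ c₂ : ℝ) : Prop where
  lt₀₁ : c₀ < c₁
  lt₁₂ : c₁ < c₂
  mapsTo : Set.MapsTo f (Set.Icc c₀ c₂) (Set.Icc c₀ c₂)
  continuousOn : ContinuousOn f (Set.Icc c₀ c₂)
  left : StrictMonoOn f (Set.Icc c₀ c₁)
  right : StrictAntiOn f (Set.Icc c₁ c₂)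

open Classical in
noncomputable def addressU (c₁ x : ℝ) : USym :=
  if x < c₁ then .l else if x = c₁ then .c else .r

/-- `𝒰`: the words `x₁ ⋯ x_{k-1} c`, `k ≥ 2`, `xᵢ ∈ {ℓ, r}`, whose periodic repetition is the
kneading sequence of a unimodal map. -/
def IsUnimodalWord (X : List USym) : Prop :=
  (∃ w : List USym, w ≠ [] ∧ (∀ x ∈ w, x ≠ .c) ∧ X = w ++ [.c]) ∧
  ∃ (f : ℝ → ℝ) (c₀ c₁ c₂ : ℝ), IsUnimodalMap f c₀ c₁ c₂ ∧
    ∀ n, addressU c₁ (f^[n + 1] c₁) = periodic .c X n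

/-- The transition matrix of a unimodal word. -/
noncomputable def markovU (X : List USym) : SqMat := markov [(USym.c, periodic .c X)]

/-! ### Bimodal kneading data and the set `𝒟` -/

/-- Bimodal maps of `[c₀, c₃]`: increasing, decreasing, increasing. -/
structure IsBimodalMap (f : ℝ → ℝ) (c₀ c₁ c₂ c₃ : ℝ) : Prop where
  lt₀₁ : c₀ < c₁
  lt₁₂ : c₁ < c₂
  lt₂₃ : c₂ < c₃
  mapsTo : Set.MapsTo f (Set.Icc c₀ c₃) (Set.Icc c₀ c₃)
  continuousOn : ContinuousOn f (Set.Icc c₀ c₃)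
  left : StrictMonoOn f (Set.Icc c₀ c₁)
  middle : StrictAntiOn f (Set.Icc c₁ c₂)
  right : StrictMonoOn f (Set.Icc c₂ c₃)

open Classical in
noncomputable def addressB (c₁ c₂ x : ℝ) : Sym :=
  if x < c₁ then .L else if x = c₁ then .A else if x < c₂ then .M else if x = c₂ then .B else .R

/-- Periodic data written as in symbolic dynamics: a pair of periodic blocks (the turning points
`A` and `B` have separate orbits), or one block ending in `A` and containing `B`
(both turning points are on one orbit). -/
inductive BlockData
  | pair (P Q : List Sym)
  | doubly (S : List Sym)

/-- Kneading sequence of `A`. -/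
def BlockData.seqA : BlockData → (ℕ → Sym)
  | .pair P _ => periodic .A P
  | .doubly S => periodic .A S

/-- Kneading sequence of `B`; on a doubly stable orbit it starts just after the symbol `B`. -/
def BlockData.seqB : BlockData → (ℕ → Sym)
  | .pair _ Q => periodic .B Q
  | .doubly S => shift^[S.idxOf .B + 1] (periodic .A S)

/-- The transition matrix of bimodal data. -/
noncomputable def BlockData.markovB (S : BlockData) : SqMat :=
  markov [(Sym.A, S.seqA), (Sym.B, S.seqB)]

/-- Conjugation of symbols. -/
def conj : Sym → Sym
  | .L => .R | .R => .L | .A => .B | .B => .A | x => x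

/-- Conjugation of words. -/
def bar (P : List Sym) : List Sym := P.map conj

/-- Symmetric data, given by the word `P = P₁ ⋯ P_{p-1}`: the pair `(P A, P̄ B)`, or the doubly
stable orbit `P B P̄ A`. -/
inductive SymData
  | pair (P : List Sym)
  | doubly (P : List Sym)

def SymData.word : SymData → List Sym
  | .pair P => P
  | .doubly P => P

/-- The number `p`. -/
def SymData.p (V : SymData) : ℕ := V.word.length + 1

def SymData.blocks : SymData → BlockData
  | .pair P => .pair (P ++ [.A]) (bar P ++ [.B])
  | .doubly P => .doubly (P ++ [.B] ++ bar P ++ [.A])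

/-- The set `𝒟`: symmetric data, with letters of `P` in `{L, M, R}`, whose two sequences are the
kneading sequences of a bimodal map. -/
def SymData.InD (V : SymData) : Prop :=
  (∀ x ∈ V.word, x = .L ∨ x = .M ∨ x = .R) ∧
  ∃ (f : ℝ → ℝ) (c₀ c₁ c₂ c₃ : ℝ), IsBimodalMap f c₀ c₁ c₂ c₃ ∧
    (∀ n, addressB c₁ c₂ (f^[n + 1] c₁) = V.blocks.seqA n) ∧
    (∀ n, addressB c₁ c₂ (f^[n + 1] c₂) = V.blocks.seqB n)

noncomputable def SymData.markovV (V : SymData) : SqMat := V.blocks.markovB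

/-- Odd `M`-parity. -/
def oddM (P : List Sym) : Bool := P.count .M % 2 = 1

/-! ### Second factors -/

/-- The translation rules for pairs of unimodal symbols. The pairs `cℓ` and `cc` do not occur,
as every word of `𝒰` starts with `r`. -/
def pairCode : USym → USym → Sym
  | .l, .l => .L
  | .l, .c => .A
  | .l, .r => .M
  | .c, _ => .B
  | .r, .r => .R
  | .r, .c => .C
  | .r, .l => .U

def translate : List USym → List Sym
  | a :: b :: t => pairCode a b :: translate t
  | _ => []

/-- Second factors: a pair `(X, X)` of unimodal words; one block (elements of `𝒢⁻`);
a pair of blocks (elements of `𝒢⁺`). -/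
inductive Factor
  | twin (X : List USym)
  | minus (w : List Sym)
  | plus (u v : List Sym)

/-- `W.Over X`: the second factor `W` comes from the unimodal word `X`, either as `(X, X)`, or by
translating `X X` (odd length) or `(X, σ X)` (even length). -/
inductive Factor.Over (X : List USym) : Factor → Prop
  | twin : Factor.Over X (.twin X)
  | minus : Odd X.length → Factor.Over X (.minus (translate (X ++ X)))
  | plus : Even X.length → Factor.Over X (.plus (translate X) (translate (X.rotate 1)))

/-- The number `k`. -/
def Factor.k : Factor → ℕ
  | .twin X => X.length
  | .minus w => w.length
  | .plus u v => u.length + v.length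

/-- Trimodal data with equal images of the two maxima `A` and `C`. -/
def trimodal (K K' : ℕ → Sym) : KneadingData Sym := [(.A, K), (.B, K'), (.C, K)]

/-- Matrices of second factors: a pair of unimodal matrices, or one trimodal matrix. -/
abbrev FactorMat := (SqMat × SqMat) ⊕ SqMat

noncomputable def Factor.markovW : Factor → FactorMat
  | .twin X => .inl (markovU X, markovU X)
  | .minus w =>
      .inr (markov (trimodal (periodic .A w) (shift^[w.idxOf .B + 1] (periodic .A w))))
  | .plus u v => .inr (markov (trimodal (periodic .A u) (periodic .B v)))

/-! ### The star product -/

/-- The symbols `A_i^±` that replace `A` in the product with `(X, X)`. -/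
def slotA (odd : Bool) : USym → Sym
  | .r => if odd then .L else .M
  | .c => .A
  | .l => if odd then .M else .L

/-- The symbols `B_i^±` that replace `B` in the product with `(X, X)`. -/
def slotB (odd : Bool) : USym → Sym
  | .r => if odd then .R else .M
  | .c => .B
  | .l => if odd then .M else .R

/-- The two symbols `(B_i^±, A_i^±)` in the products with elements of `𝒢`. -/
def slots (odd : Bool) : Sym → Sym × Sym
  | .L => if odd then (.R, .L) else (.M, .M)
  | .A => if odd then (.R, .A) else (.M, .A)
  | .M => if odd then (.R, .M) else (.M, .L)
  | .B => if odd then (.B, .M) else (.B, .L)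
  | .R => if odd then (.M, .M) else (.R, .L)
  | .C => if odd then (.M, .A) else (.R, .A)
  | .U => if odd then (.M, .L) else (.R, .M)

/-- `P B_1^± P̄ A_1^± P B_2^± P̄ A_2^± ⋯`. -/
def starWord (P w : List Sym) : List Sym :=
  w.flatMap fun z => P ++ [(slots (oddM P) z).1] ++ bar P ++ [(slots (oddM P) z).2]

/-- `B_1^± P̄ A_1^± P B_2^± P̄ A_2^± P ⋯`. -/
def starWord' (P w : List Sym) : List Sym :=
  w.flatMap fun z => [(slots (oddM P) z).1] ++ bar P ++ [(slots (oddM P) z).2] ++ P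

/-- The product `V ⋆ W`. It is defined when `V` is a pair and `W = (X, X)`, and when `V` is doubly
stable and `W` has the form of an element of `𝒢`. In the last case the second block
`Y_1 ⋯ Y_{n-1} B` of `W` is first rotated to `B Y_1 ⋯ Y_{n-1}`, and the result is shifted once. -/
def star : SymData → Factor → Option BlockData
  | .pair P, .twin X => some (.pair
      (X.flatMap fun x => P ++ [slotA (oddM P) x])
      (X.flatMap fun x => bar P ++ [slotB (oddM (bar P)) x]))
  | .doubly P, .minus w => some (.doubly (starWord P w))
  | .doubly P, .plus u v => some (.pair (starWord P u)
      ((starWord' P (v.rotate (v.length - 1))).rotate 1))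
  | _, _ => none

/-! ### Block matrices -/

/-- Data of a block pattern: the map `next` induced on the positions of the partition points, the
symbols of these points, and the orientation `rev` of the block over the turning point `A`. -/
structure BlockPattern where
  next : ℕ → ℕ
  sym : ℕ → Sym
  rev : Bool

/-- `π` is the block pattern of `V`. -/
def SymData.IsPattern (V : SymData) (π : BlockPattern) : Prop :=
  (∀ z ∈ points [(Sym.A, V.blocks.seqA), (Sym.B, V.blocks.seqB)],
    π.next (pos [(Sym.A, V.blocks.seqA), (Sym.B, V.blocks.seqB)] z) =
      pos [(Sym.A, V.blocks.seqA), (Sym.B, V.blocks.seqB)] (shift z) ∧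
    π.sym (pos [(Sym.A, V.blocks.seqA), (Sym.B, V.blocks.seqB)] z) = z 0) ∧
  π.rev = match V with
    | .pair P => oddM P
    | .doubly P => !oddM P

/-- Entries of a square matrix, `0` out of range. -/
def entry (A : SqMat) (i j : ℕ) : ℕ :=
  if h : i < A.1 ∧ j < A.1 then A.2 ⟨i, h.1⟩ ⟨j, h.2⟩ else 0

/-- The nonzero inner block in the block row of the point `i`: an identity over increasing laps, an
anti-identity over the decreasing lap, and `B` with rows or columns possibly reversed over the
turning points. -/
def innerBlock (π : BlockPattern) (B : SqMat) (i s t : ℕ) : ℕ :=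
  match π.sym i with
  | .A => entry B (if π.rev then B.1 - 1 - s else s) t
  | .B => entry B (if π.rev then s else B.1 - 1 - s) (B.1 - 1 - t)
  | .M => if s + t = B.1 - 1 then 1 else 0
  | _ => if s = t then 1 else 0

/-- Column `t` of `B` has exactly one `1`. -/
def single (B : SqMat) (t : ℕ) : Bool := ∑ s ∈ Finset.range B.1, entry B s t = 1

/-- The entries needed for continuity next to a turning point. `contEntry π B i right t` concerns
the interval to the right (`right = true`) or to the left of the block of the point `i`. -/
def contEntry (π : BlockPattern) (B : SqMat) (i : ℕ) (right : Bool) (t : ℕ) : Bool :=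
  match π.sym i with
  | .A => right == π.rev && single B t
  | .B => right == !π.rev && single B (B.1 - 1 - t)
  | _ => false

/-- The block matrix with `n + 1` groups of `m` inner indices, separated by `n` outer indices,
where `n`, `m` are the sizes of `A`, `B`. Index `i (m + 1) + s` is inner index `s` of group `i` if
`s < m`, and outer index `i` if `s = m`. -/
def blockProduct (A : SqMat) (π : BlockPattern) (B : SqMat) : SqMat :=
  ⟨(A.1 + 1) * (B.1 + 1) - 1, Matrix.of fun a b =>
    let i := a.1 / (B.1 + 1)
    let s := a.1 % (B.1 + 1)
    let j := b.1 / (B.1 + 1)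
    let t := b.1 % (B.1 + 1)
    if s < B.1 then
      -- inner row
      if t < B.1 ∧ j = π.next i then innerBlock π B i s t else 0
    else if t < B.1 then
      -- outer row, inner column: `before` and `after` are the entries in the adjacent outer columns
      let before := if j = 0 then 0 else entry A i (j - 1)
      let after := entry A i j
      if before = after then before
      else if (j = π.next i ∧ contEntry π B i true t) ∨
          (j = π.next (i + 1) ∧ contEntry π B (i + 1) false t) then 1
      else 0
    else entry A i j⟩

end SymBimodal

/-
A Markov map is replaced by the map `ν` it induces on the positions of its partition points,
together with the symbols of these points; itineraries are ordered as the positions are, so the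
transition matrix can be read off `ν` alone. A unimodal model `μ` of size `k` and a bimodal model
`ν` of size `N` combine to a bimodal map of `{0, …, N - 1} × {0, …, k - 1}` in lexicographic
order: it moves the fibers by `ν`, applying `μ` over the turning points, where the fibers are
folded, and an increasing or decreasing bijection over the laps. The star product is the kneading
data of this map, and its transition matrix is the block matrix.

To see that the blocks depend on the two matrices only, one recovers `ν` from its transition
matrix: the matrix gives the unordered images of the intervals, neighbouring images share an
endpoint, and the orientation of the last interval is known. A trimodal second factor is a model
of the second iterate of the unimodal map.
-/

namespace SymBimodal

section Sequences

variable {α : Type}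

lemma SeqLT.asymm [LapAlphabet α] {S T : ℕ → α} (h : SeqLT S T) : ¬ SeqLT T S := by
  rintro ⟨j, hj, hlt⟩
  obtain ⟨i, hi, hlt'⟩ := h
  rcases lt_trichotomy i j with hij | rfl | hij
  · rw [hj i hij] at hlt'
    exact lt_irrefl _ hlt'
  · rw [Finset.prod_congr rfl fun n hn => by rw [hj n (Finset.mem_range.1 hn)]] at hlt
    exact lt_asymm hlt hlt'
  · rw [hi j hij] at hlt
    exact lt_irrefl _ hlt

lemma SeqLT.irrefl [LapAlphabet α] (S : ℕ → α) : ¬ SeqLT S S := fun h => h.asymm h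

@[simp] lemma shift_consSeq (x : α) (S : ℕ → α) : shift (consSeq x S) = S := rfl

lemma consSeq_shift (S : ℕ → α) : consSeq (S 0) (shift S) = S := by
  funext n; cases n <;> rfl

lemma shift_iterate_apply (S : ℕ → α) (n m : ℕ) : shift^[n] S m = S (m + n) := by
  induction n generalizing S with
  | zero => rfl
  | succ n ih => rw [Function.iterate_succ_apply, ih]; simp only [shift, Nat.add_assoc]

/-- The itinerary of the position `i` under `ν`, with addresses `sy`. -/
def itin (ν : ℕ → ℕ) (sy : ℕ → α) (i : ℕ) : ℕ → α := fun n => sy (ν^[n] i)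

lemma shift_itin (ν : ℕ → ℕ) (sy : ℕ → α) (i : ℕ) :
    shift (itin ν sy i) = itin ν sy (ν i) := rfl

lemma shift_iterate_itin (ν : ℕ → ℕ) (sy : ℕ → α) (i n : ℕ) :
    shift^[n] (itin ν sy i) = itin ν sy (ν^[n] i) := by
  funext m
  rw [shift_iterate_apply, itin, itin, Function.iterate_add_apply]

lemma itin_eq_consSeq (ν : ℕ → ℕ) (sy : ℕ → α) (i : ℕ) :
    itin ν sy i = consSeq (sy i) (itin ν sy (ν i)) := (consSeq_shift _).symm

lemma iterate_lt {N : ℕ} {ν : ℕ → ℕ} (h : ∀ i < N, ν i < N) {i : ℕ} (hi : i < N) (n : ℕ) :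
    ν^[n] i < N := by
  induction n with
  | zero => exact hi
  | succ n ih => rw [Function.iterate_succ_apply']; exact h _ ih

end Sequences

/-! ### Maps of finite chains and their transition matrices -/

/-- The laps have the ranks `0, 2, 4, …` and alternate between increasing and decreasing; the
turning points have the odd ranks in between. -/
class AlternatingAlphabet (α : Type) [LapAlphabet α] : Prop where
  rank_injective : Function.Injective (LapAlphabet.rank : α → ℤ)
  eps_eq (x : α) : LapAlphabet.eps x =
    if LapAlphabet.rank x % 4 = 0 then 1 else if LapAlphabet.rank x % 4 = 2 then -1 else 0

instance : AlternatingAlphabet USym where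
  rank_injective x y h := by cases x <;> cases y <;> first | rfl | exact absurd h (by decide)
  eps_eq x := by cases x <;> rfl

instance : AlternatingAlphabet Sym where
  rank_injective x y h := by cases x <;> cases y <;> first | rfl | exact absurd h (by decide)
  eps_eq x := by cases x <;> rfl

section Models

variable {α : Type} [LapAlphabet α]

open LapAlphabet (rank eps)

/-- `Ascending x`: a map increases immediately to the right of a point with symbol `x`. -/
def Ascending (x : α) : Prop := rank x % 4 = 0 ∨ rank x % 4 = 3

instance (x : α) : Decidable (Ascending x) := by unfold Ascending; infer_instance

variable {N : ℕ} {ν : ℕ → ℕ} {sy : ℕ → α}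

/-- A Markov map, given by the map `ν` it induces on its partition points `0 < ⋯ < N - 1` and their
symbols `sy`: the partition points are the turning points and their iterates, and every orbit
returns to a turning point. -/
structure IsModel (N : ℕ) (ν : ℕ → ℕ) (sy : ℕ → α) : Prop where
  maps : ∀ i < N, ν i < N
  step : ∀ i, i + 1 < N → if Ascending (sy i) then ν i < ν (i + 1) else ν (i + 1) < ν i
  mono : ∀ i, i + 1 < N →
    rank (sy i) < rank (sy (i + 1)) ∨ sy i = sy (i + 1) ∧ eps (sy i) ≠ 0
  turn : ∀ i < N, ∃ n, eps (sy (ν^[n] i)) = 0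
  cover : ∀ i < N, ∃ t < N, eps (sy t) = 0 ∧ ∃ n, ν^[n] t = i

namespace IsModel

lemma ne_succ (h : IsModel N ν sy) {i : ℕ} (hi : i + 1 < N) : ν i ≠ ν (i + 1) := by
  have := h.step i hi
  split_ifs at this <;> omega

lemma rank_mono (h : IsModel N ν sy) {i j : ℕ} (hij : i ≤ j) (hj : j < N) :
    rank (sy i) ≤ rank (sy j) := by
  induction j, hij using Nat.le_induction with
  | base => exact le_rfl
  | succ j _ ih =>
    refine (ih (by omega)).trans ?_
    rcases h.mono j hj with hlt | ⟨heq, -⟩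
    · exact hlt.le
    · rw [heq]

variable [AlternatingAlphabet α]

lemma lap (h : IsModel N ν sy) {i j : ℕ} (hij : i < j) (hj : j < N) (hs : sy i = sy j) :
    (eps (sy i) = 1 ∧ ν i < ν j) ∨ (eps (sy i) = -1 ∧ ν j < ν i) := by
  have step : ∀ n, n + 1 < N → sy n = sy (n + 1) →
      (eps (sy n) = 1 ∧ ν n < ν (n + 1)) ∨ (eps (sy n) = -1 ∧ ν (n + 1) < ν n) := by
    intro n hn heq
    have heps := AlternatingAlphabet.eps_eq (sy n)
    have hturn := ((h.mono n hn).resolve_left (by rw [heq]; exact lt_irrefl _)).2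
    have hstep := h.step n hn
    by_cases hasc : Ascending (sy n) <;> simp only [hasc, if_true, if_false] at hstep <;>
      unfold Ascending at hasc <;> split_ifs at heps <;> omega
  induction j, hij using Nat.le_induction with
  | base => exact step i hj hs
  | succ j hij ih =>
    have hij' : sy i = sy j := AlternatingAlphabet.rank_injective <|
      (h.rank_mono (by omega) (by omega)).antisymm (hs ▸ h.rank_mono (by omega) hj)
    have h1 := ih (by omega) hij'
    have h2 := step j hj (hij'.symm.trans hs)
    rw [← hij'] at h2
    omega

lemma rank_lt (h : IsModel N ν sy) {i j : ℕ} (hij : i < j) (hj : j < N) (hne : sy i ≠ sy j) :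
    rank (sy i) < rank (sy j) :=
  (h.rank_mono hij.le hj).lt_of_ne (AlternatingAlphabet.rank_injective.ne hne)

lemma sign_order (h : IsModel N ν sy) {i j : ℕ} (hij : i < j) (hj : j < N) (m : ℕ)
    (heq : ∀ n < m, itin ν sy i n = itin ν sy j n) :
    (∏ n ∈ Finset.range m, eps (itin ν sy i n) = 1 ∧ ν^[m] i < ν^[m] j) ∨
    (∏ n ∈ Finset.range m, eps (itin ν sy i n) = -1 ∧ ν^[m] j < ν^[m] i) := by
  induction m with
  | zero => left; simpa using hij
  | succ m ih =>
    have hm : sy (ν^[m] i) = sy (ν^[m] j) := heq m (by omega)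
    rw [Finset.prod_range_succ, Function.iterate_succ_apply', Function.iterate_succ_apply',
      show itin ν sy i m = sy (ν^[m] i) from rfl]
    rcases ih fun n hn => heq n (by omega) with ⟨h1, h2⟩ | ⟨h1, h2⟩
    · rcases h.lap h2 (iterate_lt h.maps hj m) hm with ⟨h3, h4⟩ | ⟨h3, h4⟩
      · left; simp only [h1, h3, mul_one, h4, and_self]
      · right; simp only [h1, h3, one_mul, h4, and_self]
    · rcases h.lap h2 (iterate_lt h.maps (hij.trans hj) m) hm.symm with ⟨h3, h4⟩ | ⟨h3, h4⟩
      · right; simp only [h1, hm, h3, mul_one, h4, and_self]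
      · left; simp only [h1, hm, h3, mul_neg, mul_one, neg_neg, h4, and_self]

lemma itin_ne (h : IsModel N ν sy) {i j : ℕ} (hij : i < j) (hj : j < N) :
    ∃ m, itin ν sy i m ≠ itin ν sy j m := by
  by_contra! hall
  obtain ⟨n, hn⟩ := h.turn i (hij.trans hj)
  have hn' : sy (ν^[n] i) = sy (ν^[n] j) := hall n
  rcases h.sign_order hij hj n fun m _ => hall m with ⟨-, h2⟩ | ⟨-, h2⟩
  · have := h.lap h2 (iterate_lt h.maps hj n) hn'
    omega
  · have := h.lap h2 (iterate_lt h.maps (hij.trans hj) n) hn'.symm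
    rw [← hn'] at this
    omega

lemma itin_lt (h : IsModel N ν sy) {i j : ℕ} (hij : i < j) (hj : j < N) :
    SeqLT (itin ν sy i) (itin ν sy j) := by
  classical
  have hex := h.itin_ne hij hj
  have hne := Nat.find_spec hex
  have heq : ∀ n < Nat.find hex, itin ν sy i n = itin ν sy j n := fun n hn =>
    not_not.1 (Nat.find_min hex hn)
  refine ⟨Nat.find hex, heq, ?_⟩
  rcases h.sign_order hij hj _ heq with ⟨h1, h2⟩ | ⟨h1, h2⟩
  · rw [h1, one_mul, one_mul]
    exact h.rank_lt h2 (iterate_lt h.maps hj _) hne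
  · rw [h1, neg_one_mul, neg_one_mul, neg_lt_neg_iff]
    exact h.rank_lt h2 (iterate_lt h.maps (hij.trans hj) _) (Ne.symm hne)

lemma itin_lt_iff (h : IsModel N ν sy) {i j : ℕ} (hi : i < N) (hj : j < N) :
    SeqLT (itin ν sy i) (itin ν sy j) ↔ i < j := by
  refine ⟨fun hlt => ?_, fun hij => h.itin_lt hij hj⟩
  rcases lt_trichotomy i j with hij | rfl | hij
  · exact hij
  · exact absurd hlt (SeqLT.irrefl _)
  · exact absurd hlt (h.itin_lt hij hi).asymm

lemma itin_injOn (h : IsModel N ν sy) : Set.InjOn (itin ν sy) (Set.Iio N) := by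
  intro i hi j hj hij
  rcases lt_trichotomy i j with hlt | rfl | hlt
  · exact absurd (hij ▸ h.itin_lt hlt hj) (SeqLT.irrefl _)
  · rfl
  · exact absurd (hij ▸ h.itin_lt hlt hi) (SeqLT.irrefl _)

end IsModel

/-- The kneading data of a model with turning points at the positions in `T`. -/
def kneading (ν : ℕ → ℕ) (sy : ℕ → α) (T : List ℕ) : KneadingData α :=
  T.map fun t => (sy t, itin ν sy (ν t))

/-- `Btw x y j`: the interval between the points `x` and `y` contains the interval `[j, j + 1]`. -/
def Btw (x y j : ℕ) : Prop := (x ≤ j ∧ j < y) ∨ (y ≤ j ∧ j < x)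

instance (x y j : ℕ) : Decidable (Btw x y j) := by unfold Btw; infer_instance

/-- The transition matrix of a map `ν` of `{0, …, N - 1}`. -/
def matOf (N : ℕ) (ν : ℕ → ℕ) : SqMat :=
  ⟨N - 1, Matrix.of fun i j => if Btw (ν i) (ν (i + 1)) j then 1 else 0⟩

section Markov

variable {T : List ℕ}

lemma IsModel.points_kneading (h : IsModel N ν sy) (hT : ∀ t, t ∈ T ↔ t < N ∧ eps (sy t) = 0) :
    points (kneading ν sy T) = itin ν sy '' Set.Iio N := by
  ext z
  simp only [points, kneading, List.mem_map, exists_exists_and_eq_and, ← itin_eq_consSeq,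
    shift_iterate_itin, Set.mem_ofPred_eq, Set.mem_image, Set.mem_Iio]
  constructor
  · rintro ⟨t, ht, n, rfl⟩
    exact ⟨_, iterate_lt h.maps ((hT t).1 ht).1 n, rfl⟩
  · rintro ⟨i, hi, rfl⟩
    obtain ⟨t, ht, heps, n, rfl⟩ := h.cover i hi
    exact ⟨t, (hT t).2 ⟨ht, heps⟩, n, rfl⟩

variable [AlternatingAlphabet α]

lemma IsModel.pos_itin (h : IsModel N ν sy) (hT : ∀ t, t ∈ T ↔ t < N ∧ eps (sy t) = 0) {i : ℕ}
    (hi : i < N) : pos (kneading ν sy T) (itin ν sy i) = i := by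
  have : {y ∈ points (kneading ν sy T) | SeqLT y (itin ν sy i)} = itin ν sy '' Set.Iio i := by
    rw [h.points_kneading hT]
    ext y
    constructor
    · rintro ⟨⟨j, hj, rfl⟩, hlt⟩
      exact ⟨j, (h.itin_lt_iff hj hi).1 hlt, rfl⟩
    · rintro ⟨j, hj, rfl⟩
      exact ⟨⟨j, lt_trans hj hi, rfl⟩, h.itin_lt hj hi⟩
  rw [pos, this, (h.itin_injOn.mono (Set.Iio_subset_Iio hi.le)).ncard_image,
    Set.ncard_eq_toFinset_card', Set.toFinset_Iio, Nat.card_Iio]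

lemma IsModel.covers_iff (h : IsModel N ν sy) (hT : ∀ t, t ∈ T ↔ t < N ∧ eps (sy t) = 0) {i j : ℕ}
    (hi : i + 1 < N) : Covers (kneading ν sy T) i j ↔ Btw (ν i) (ν (i + 1)) j := by
  have hbtw : min (ν i) (ν (i + 1)) ≤ j ∧ j < max (ν i) (ν (i + 1)) ↔
      Btw (ν i) (ν (i + 1)) j := by
    unfold Btw; omega
  have hpos : ∀ x < N, pos (kneading ν sy T) (shift (itin ν sy x)) = ν x := fun x hx => by
    rw [shift_itin, h.pos_itin hT (h.maps x hx)]
  have hi' : i < N := by omega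
  rw [← hbtw, Covers, h.points_kneading hT]
  constructor
  · rintro ⟨_, ⟨x, hx, rfl⟩, _, ⟨y, hy, rfl⟩, h1, h2, h3⟩
    rw [h.pos_itin hT hx] at h1
    rw [h.pos_itin hT hy] at h2
    rwa [hpos x hx, hpos y hy, h1, h2] at h3
  · intro h3
    refine ⟨_, ⟨i, hi', rfl⟩, _, ⟨i + 1, hi, rfl⟩, h.pos_itin hT hi', h.pos_itin hT hi, ?_⟩
    rwa [hpos _ hi', hpos _ hi]

lemma IsModel.markov_kneading (h : IsModel N ν sy) (hT : ∀ t, t ∈ T ↔ t < N ∧ eps (sy t) = 0) :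
    markov (kneading ν sy T) = matOf N ν := by
  have hcard : (points (kneading ν sy T)).ncard = N := by
    rw [h.points_kneading hT, h.itin_injOn.ncard_image, Set.ncard_eq_toFinset_card',
      Set.toFinset_Iio, Nat.card_Iio]
  rw [markov, matOf, hcard]
  congr 1
  ext i j
  have hi := i.2
  simp only [Matrix.of_apply, h.covers_iff hT (show (i : ℕ) + 1 < N by omega)]

end Markov

end Models

section SquareMatrices

variable {N : ℕ} {ν ν' : ℕ → ℕ}

lemma entry_matOf (h : ∀ i < N, ν i < N) (i j : ℕ) :
    entry (matOf N ν) i j = if i + 1 < N ∧ Btw (ν i) (ν (i + 1)) j then 1 else 0 := by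
  unfold entry
  by_cases hi : i + 1 < N
  · have h1 := h i (by omega)
    have h2 := h (i + 1) hi
    by_cases hb : Btw (ν i) (ν (i + 1)) j
    · have : i < (matOf N ν).1 ∧ j < (matOf N ν).1 := by
        unfold Btw at hb; simp only [matOf]; omega
      rw [dif_pos this, if_pos ⟨hi, hb⟩]
      simp only [matOf, Matrix.of_apply, hb, if_true]
    · rw [if_neg fun h => hb h.2]
      split_ifs
      · simp only [matOf, Matrix.of_apply, hb, if_false]
      · rfl
  · rw [if_neg fun h => hi h.1, dif_neg]
    simp only [matOf]; omega

lemma sqMat_ext {A B : SqMat} (h : A.1 = B.1)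
    (he : ∀ i < A.1, ∀ j < A.1, entry A i j = entry B i j) : A = B := by
  obtain ⟨n, A⟩ := A
  obtain ⟨m, B⟩ := B
  obtain rfl : n = m := h
  congr 1
  ext i j
  simpa [entry] using he i i.2 j j.2

lemma image_pair_eq_of_matOf_eq (h : ∀ i < N, ν i < N) (h' : ∀ i < N, ν' i < N)
    (heq : matOf N ν = matOf N ν') {i : ℕ} (hi : i + 1 < N) (hne' : ν' i ≠ ν' (i + 1)) :
    (ν i = ν' i ∧ ν (i + 1) = ν' (i + 1)) ∨ (ν i = ν' (i + 1) ∧ ν (i + 1) = ν' i) := by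
  have key : ∀ j, Btw (ν i) (ν (i + 1)) j ↔ Btw (ν' i) (ν' (i + 1)) j := by
    intro j
    have := entry_matOf h i j
    rw [heq, entry_matOf h' i j] at this
    simp only [hi, true_and] at this
    split_ifs at this <;> simp_all
  have k1 := key (ν i)
  have k2 := key (ν (i + 1))
  have k3 := key (ν' i)
  have k4 := key (ν' (i + 1))
  have k5 := key (ν i - 1)
  have k6 := key (ν (i + 1) - 1)
  have k7 := key (ν' i - 1)
  have k8 := key (ν' (i + 1) - 1)
  unfold Btw at *
  omega

lemma matOf_size_eq {N' : ℕ} (hN : 0 < N) (hN' : 0 < N') (h : matOf N ν = matOf N' ν') :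
    N = N' := by
  have : N - 1 = N' - 1 := congrArg Sigma.fst h
  omega

end SquareMatrices

/-- The image of the last interval of the chain is oriented, and neighbouring images are tied
together by their common endpoint. -/
lemma IsModel.eqOn_of_matOf_eq {α : Type} [LapAlphabet α] {N : ℕ} {ν ν' : ℕ → ℕ} {sy sy' : ℕ → α}
    (h : IsModel N ν sy) (h' : IsModel N ν' sy') (hN : 2 ≤ N) (heq : matOf N ν = matOf N ν')
    (hlast : Ascending (sy (N - 2)) ↔ Ascending (sy' (N - 2))) : ∀ i < N, ν i = ν' i := by
  have pair : ∀ i, i + 1 < N →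
      (ν i = ν' i ∧ ν (i + 1) = ν' (i + 1)) ∨ (ν i = ν' (i + 1) ∧ ν (i + 1) = ν' i) :=
    fun i hi => image_pair_eq_of_matOf_eq h.maps h'.maps heq hi (h'.ne_succ hi)
  obtain ⟨n, rfl⟩ := Nat.exists_eq_add_of_le' hN
  have down : ∀ m ≤ n + 1, ν (n + 1 - m) = ν' (n + 1 - m) := by
    intro m
    induction m with
    | zero =>
      intro _
      have h1 := h.step n (by omega)
      have h2 := h'.step n (by omega)
      have h3 := pair n (by omega)
      simp only [Nat.add_sub_cancel] at hlast
      simp only [hlast, Nat.sub_zero] at h1 h2 ⊢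
      split_ifs at h1 h2 <;> omega
    | succ m ih =>
      intro hm
      have hi := ih (by omega)
      have h1 := h.ne_succ (i := n - m) (by omega)
      have h3 := pair (n - m) (by omega)
      rw [show n + 1 - m = n - m + 1 by omega] at hi
      rw [show n + 1 - (m + 1) = n - m by omega]
      omega
  intro i hi
  simpa only [Nat.sub_sub_self (show i ≤ n + 1 by omega)] using down (n + 1 - i) (by omega)

lemma itin_congr {α : Type} {N : ℕ} {ν ν' : ℕ → ℕ} (h : ∀ i < N, ν i < N)
    (heq : ∀ i < N, ν i = ν' i) (sy : ℕ → α) {i : ℕ} (hi : i < N) : itin ν sy i = itin ν' sy i := by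
  have iterate_eq : ∀ n, ν^[n] i = ν'^[n] i := by
    intro n
    induction n with
    | zero => rfl
    | succ n ih =>
      rw [Function.iterate_succ_apply', Function.iterate_succ_apply', ← ih,
        heq _ (iterate_lt h hi n)]
  funext n
  rw [itin, itin, iterate_eq]

open LapAlphabet (rank eps)

section Models
variable {α : Type} [LapAlphabet α] {N : ℕ} {ν : ℕ → ℕ} {sy : ℕ → α}

lemma IsModel.congr_sym {sy' : ℕ → α} (h : IsModel N ν sy) (hs : ∀ i < N, sy' i = sy i) :
    IsModel N ν sy' where
  maps := h.maps
  step i hi := by rw [hs i (by omega)]; exact h.step i hi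
  mono i hi := by rw [hs i (by omega), hs (i + 1) hi]; exact h.mono i hi
  turn i hi := (h.turn i hi).imp fun n hn => by rwa [hs _ (iterate_lt h.maps hi n)]
  cover i hi := by
    obtain ⟨t, ht, heps, hn⟩ := h.cover i hi
    exact ⟨t, ht, by rwa [hs t ht], hn⟩

lemma IsModel.lt_of_ascending (h : IsModel N ν sy) {i j : ℕ} (hij : i < j) (hj : j < N)
    (hasc : ∀ n, i ≤ n → n < j → Ascending (sy n)) : ν i < ν j := by
  induction j, hij using Nat.le_induction with
  | base => simpa only [hasc i le_rfl (by omega), if_true] using h.step i hj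
  | succ j hij ih =>
    have hstep := h.step j hj
    rw [if_pos (hasc j (by omega) (by omega))] at hstep
    exact (ih (by omega) fun n h1 h2 => hasc n h1 (by omega)).trans hstep

lemma IsModel.lt_of_not_ascending (h : IsModel N ν sy) {i j : ℕ} (hij : i < j) (hj : j < N)
    (hdesc : ∀ n, i ≤ n → n < j → ¬ Ascending (sy n)) : ν j < ν i := by
  induction j, hij using Nat.le_induction with
  | base => simpa only [hdesc i le_rfl (by omega), if_false] using h.step i hj
  | succ j hij ih =>
    have hstep := h.step j hj
    rw [if_neg (hdesc j (by omega) (by omega))] at hstep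
    exact hstep.trans (ih (by omega) fun n h1 h2 => hdesc n h1 (by omega))

end Models

/-! ### Unimodal, bimodal and trimodal models -/

/-- The symbol of the position `i` if `κ` is the turning point. -/
def usym (κ i : ℕ) : USym := if i < κ then .l else if i = κ then .c else .r

/-- The symbol of the position `i` if `a < b` are the turning points. -/
def bsym (a b i : ℕ) : Sym :=
  if i < a then .L else if i = a then .A else if i < b then .M else if i = b then .B else .R

/-- The symbol of the position `i` if `a < b < c` are the turning points. -/
def tsym (a b c i : ℕ) : Sym :=
  if i < b then bsym a b i else if i = b then .B else if i < c then .R else if i = c then .C else .U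

section Symbols

variable {κ a b c i : ℕ}

lemma usym_eq_c : usym κ i = .c ↔ i = κ := by
  unfold usym; split_ifs <;> simp <;> omega

lemma usym_eq_r : usym κ i = .r ↔ κ < i := by
  unfold usym; split_ifs <;> simp <;> omega

lemma eps_usym : eps (usym κ i) = 0 ↔ i = κ := by
  rw [← usym_eq_c]; cases usym κ i <;> decide

lemma ascending_usym : Ascending (usym κ i) ↔ i < κ := by
  unfold usym; split_ifs <;> simp_all [Ascending, rank]

lemma bsym_eq_L : bsym a b i = .L ↔ i < a := by
  unfold bsym; split_ifs <;> simp <;> omega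

lemma bsym_eq_A : bsym a b i = .A ↔ i = a := by
  unfold bsym; split_ifs <;> simp <;> omega

lemma bsym_eq_B (hab : a < b) : bsym a b i = .B ↔ i = b := by
  unfold bsym; split_ifs <;> simp <;> omega

lemma bsym_eq_R (hab : a < b) : bsym a b i = .R ↔ b < i := by
  unfold bsym; split_ifs <;> simp <;> omega

lemma eps_bsym (hab : a < b) : eps (bsym a b i) = 0 ↔ i = a ∨ i = b := by
  unfold bsym; split_ifs <;> simp [eps] <;> omega

lemma ascending_bsym (hab : a < b) : Ascending (bsym a b i) ↔ i < a ∨ b ≤ i := by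
  unfold bsym; split_ifs <;> simp [Ascending, rank] <;> omega

lemma bsym_mono (a b i : ℕ) : rank (bsym a b i) < rank (bsym a b (i + 1)) ∨
    bsym a b i = bsym a b (i + 1) ∧ eps (bsym a b i) ≠ 0 := by
  unfold bsym; split_ifs <;> first | decide | omega

lemma tsym_eq_A (hab : a < b) : tsym a b c i = .A ↔ i = a := by
  unfold tsym bsym; split_ifs <;> simp <;> omega

lemma tsym_eq_B : tsym a b c i = .B ↔ i = b := by
  unfold tsym bsym; split_ifs <;> simp <;> omega

lemma eps_tsym (hab : a < b) (hbc : b < c) :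
    eps (tsym a b c i) = 0 ↔ i = a ∨ i = b ∨ i = c := by
  unfold tsym bsym; split_ifs <;> simp [eps] <;> omega

lemma ascending_tsym (hab : a < b) (hbc : b < c) :
    Ascending (tsym a b c i) ↔ i < a ∨ b ≤ i ∧ i < c := by
  unfold tsym bsym; split_ifs <;> simp [Ascending, rank] <;> omega

lemma tsym_mono (hbc : b < c) (i : ℕ) :
    rank (tsym a b c i) < rank (tsym a b c (i + 1)) ∨
      tsym a b c i = tsym a b c (i + 1) ∧ eps (tsym a b c i) ≠ 0 := by
  unfold tsym bsym; split_ifs <;> first | decide | omega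

end Symbols

/-- A model of a unimodal Markov map of `{0, …, k - 1}` with turning point `κ`. -/
structure UnimodalModel (k κ : ℕ) (μ : ℕ → ℕ) : Prop extends IsModel k μ (usym κ) where
  lt : κ < k

/-- A model of a bimodal Markov map of `{0, …, N - 1}` with turning points `a < b`. -/
structure BimodalModel (N a b : ℕ) (ν : ℕ → ℕ) : Prop extends IsModel N ν (bsym a b) where
  ab : a < b
  bN : b < N

/-- A model of a trimodal Markov map of `{0, …, N - 1}` with turning points `a < b < c`, where the
two maxima have the same value. -/
structure TrimodalModel (N a b c : ℕ) (ν : ℕ → ℕ) : Prop extends IsModel N ν (tsym a b c) where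
  ab : a < b
  bc : b < c
  cN : c < N
  top : ν a = ν c

section

variable {N a b c k κ : ℕ} {μ ν : ℕ → ℕ}

lemma UnimodalModel.left (h : UnimodalModel k κ μ) {i j : ℕ} (hij : i < j) (hj : j ≤ κ) :
    μ i < μ j :=
  h.lt_of_ascending hij (hj.trans_lt h.lt) fun _ _ hn => ascending_usym.2 (hn.trans_le hj)

lemma UnimodalModel.right (h : UnimodalModel k κ μ) {i j : ℕ} (hi : κ ≤ i) (hij : i < j)
    (hj : j < k) : μ j < μ i :=
  h.lt_of_not_ascending hij hj fun _ hn _ => ascending_usym.not.2 (by omega)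

lemma UnimodalModel.markov_eq (h : UnimodalModel k κ μ) {K : ℕ → USym}
    (hK : consSeq .c K = itin μ (usym κ) κ) : markov [(.c, K)] = matOf k μ := by
  have hdata : [(USym.c, K)] = kneading μ (usym κ) [κ] := by
    rw [← shift_consSeq .c K, hK, kneading, List.map_singleton, usym_eq_c.2 rfl, shift_itin]
  rw [hdata]
  refine h.markov_kneading fun t => ?_
  have := h.lt
  rw [eps_usym, List.mem_singleton]
  omega

lemma BimodalModel.markov_eq (h : BimodalModel N a b ν) {K K' : ℕ → Sym}
    (hK : consSeq .A K = itin ν (bsym a b) a) (hK' : consSeq .B K' = itin ν (bsym a b) b) :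
    markov [(.A, K), (.B, K')] = matOf N ν := by
  have hdata : [(Sym.A, K), (Sym.B, K')] = kneading ν (bsym a b) [a, b] := by
    simp only [kneading, List.map_cons, List.map_nil, bsym_eq_A.2, (bsym_eq_B h.ab).2,
      ← shift_itin, ← hK, ← hK', shift_consSeq]
  rw [hdata]
  refine h.markov_kneading fun t => ?_
  have := h.ab
  have := h.bN
  rw [eps_bsym h.ab]
  simp only [List.mem_cons, List.not_mem_nil, or_false]
  omega

lemma TrimodalModel.markov_eq (h : TrimodalModel N a b c ν) {K K' : ℕ → Sym}
    (hK : K = itin ν (tsym a b c) (ν a)) (hK' : consSeq .B K' = itin ν (tsym a b c) b) :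
    markov (trimodal K K') = matOf N ν := by
  have hab := h.ab
  have hbc := h.bc
  have hcN := h.cN
  have symC : tsym a b c c = .C := by simp [tsym, hbc.not_gt, hbc.ne']
  have hdata : trimodal K K' = kneading ν (tsym a b c) [a, b, c] := by
    simp only [trimodal, kneading, List.map_cons, List.map_nil, (tsym_eq_A hab).2, symC,
      tsym_eq_B.2, ← h.top, ← hK]
    rw [← shift_itin ν (tsym a b c) b, ← hK', shift_consSeq]
  rw [hdata]
  refine h.markov_kneading fun t => ?_
  rw [eps_tsym hab hbc]
  simp only [List.mem_cons, List.not_mem_nil, or_false]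
  omega

end

/-! ### Models of Markov interval maps -/

section Enumeration

variable {R : Type*} [LinearOrder R]

lemma exists_enumeration (E : Finset R) (hE : E.Nonempty) {f : R → R} (hf : ∀ x ∈ E, f x ∈ E) :
    ∃ (e : ℕ → R) (ν : ℕ → ℕ), Set.BijOn e (Set.Iio E.card) E ∧ StrictMonoOn e (Set.Iio E.card) ∧
      (∀ i < E.card, ν i < E.card) ∧ ∀ i < E.card, e (ν i) = f (e i) := by
  obtain ⟨x₀, -⟩ := hE
  let o := E.orderIsoOfFin rfl
  let e : ℕ → R := fun i => if h : i < E.card then o ⟨i, h⟩ else x₀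
  have he : ∀ i (h : i < E.card), e i = o ⟨i, h⟩ := fun i h => dif_pos h
  have hmono : StrictMonoOn e (Set.Iio E.card) := fun i hi j hj hij => by
    rw [he i hi, he j hj]
    exact o.strictMono hij
  have hbij : Set.BijOn e (Set.Iio E.card) E := by
    refine ⟨fun i hi => by rw [he i hi]; exact (o _).2, hmono.injOn, fun x hx => ?_⟩
    refine ⟨o.symm ⟨x, hx⟩, (o.symm ⟨x, hx⟩).2, ?_⟩
    rw [he _ (o.symm ⟨x, hx⟩).2, Fin.eta, o.apply_symm_apply]
  have hnext : ∀ i, ∃ j, i < E.card → j < E.card ∧ e j = f (e i) := fun i => by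
    by_cases hi : i < E.card
    · obtain ⟨j, hj, hej⟩ := hbij.surjOn (hf _ (hbij.mapsTo hi))
      exact ⟨j, fun _ => ⟨hj, hej⟩⟩
    · exact ⟨0, fun h => absurd h hi⟩
  choose ν hν using hnext
  exact ⟨e, ν, hbij, hmono, fun i hi => (hν i hi).1, fun i hi => (hν i hi).2⟩

end Enumeration

/-- The orbits of the points `c b` are disjoint up to time `p`, when `c b` has reached `c (τ b)`. -/
structure IsPeriodicOrbits {R β : Type*} (f : R → R) (c : β → R) (τ : β → β) (p : ℕ) : Prop where
  pos : 0 < p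
  inj : Function.Injective c
  inj_perm : Function.Injective τ
  iterate_period : ∀ b, f^[p] (c b) = c (τ b)
  not_return : ∀ b b' n, 0 < n → n < p → f^[n] (c b) ≠ c b'

namespace IsPeriodicOrbits

variable {R β : Type*} {f : R → R} {c : β → R} {τ : β → β} {p : ℕ}

lemma iterate_inj (h : IsPeriodicOrbits f c τ p) {n m : ℕ} (hnm : n ≤ m) (hm : m < p) {b b' : β}
    (heq : f^[n] (c b) = f^[m] (c b')) : n = m ∧ b = b' := by
  have h1 : f^[p - m + n] (c b) = c (τ b') := by
    rw [Function.iterate_add_apply, heq, ← Function.iterate_add_apply, Nat.sub_add_cancel hm.le,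
      h.iterate_period]
  rcases hnm.lt_or_eq with hlt | rfl
  · exact absurd h1 (h.not_return _ _ _ (by omega) (by omega))
  · rw [Nat.sub_add_cancel hm.le, h.iterate_period] at h1
    exact ⟨rfl, h.inj_perm (h.inj h1)⟩

lemma iterate_sub (h : IsPeriodicOrbits f c τ p) {n : ℕ} (hn : n < p) (b : β) :
    f^[p - n] (f^[n] (c b)) = c (τ b) := by
  rw [← Function.iterate_add_apply, Nat.sub_add_cancel hn.le, h.iterate_period]

lemma exists_finset [Fintype β] (h : IsPeriodicOrbits f c τ p) :
    ∃ E : Finset R, E.card = Fintype.card β * p ∧ (∀ x, x ∈ E ↔ ∃ b, ∃ n < p, f^[n] (c b) = x) ∧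
      ∀ x ∈ E, f x ∈ E := by
  classical
  let E := (Finset.univ ×ˢ Finset.range p).image fun q : β × ℕ => f^[q.2] (c q.1)
  have hmem : ∀ x, x ∈ E ↔ ∃ b, ∃ n < p, f^[n] (c b) = x := fun x => by
    simp only [E, Finset.mem_image, Finset.mem_product, Finset.mem_univ, Finset.mem_range, true_and,
      Prod.exists]
  refine ⟨E, ?_, hmem, fun x hx => ?_⟩
  · rw [Finset.card_image_of_injOn, Finset.card_product, Finset.card_univ, Finset.card_range]
    rintro ⟨b, n⟩ hn ⟨b', m⟩ hm heq
    rw [Finset.mem_coe, Finset.mem_product, Finset.mem_range] at hn hm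
    rcases le_total n m with hnm | hnm
    · obtain ⟨rfl, rfl⟩ := h.iterate_inj hnm hm.2 heq; rfl
    · obtain ⟨rfl, rfl⟩ := h.iterate_inj hnm hn.2 heq.symm; rfl
  · rw [hmem] at hx ⊢
    obtain ⟨b, n, hn, rfl⟩ := hx
    rw [← Function.iterate_succ_apply' f n]
    rcases Nat.lt_or_ge (n + 1) p with hlt | hge
    · exact ⟨b, n + 1, hlt, rfl⟩
    · obtain rfl : n + 1 = p := by omega
      exact ⟨τ b, 0, h.pos, (h.iterate_period b).symm⟩

lemma exists_isModel [Fintype β] [Nonempty β] [LinearOrder R] {α : Type} [LapAlphabet α]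
    (h : IsPeriodicOrbits f c τ p) {I : Set R} (hI : Set.MapsTo f I I) (hcI : ∀ b, c b ∈ I)
    {ad : R → α} (hturn : ∀ b, eps (ad (c b)) = 0)
    (hstep : ∀ x ∈ I, ∀ y ∈ I, x < y → (∀ b, c b ≤ x ∨ y ≤ c b) →
      (if Ascending (ad x) then f x < f y else f y < f x) ∧
      (rank (ad x) < rank (ad y) ∨ ad x = ad y ∧ eps (ad x) ≠ 0)) :
    ∃ (e : ℕ → R) (ν : ℕ → ℕ), IsModel (Fintype.card β * p) ν (ad ∘ e) ∧
      StrictMonoOn e (Set.Iio (Fintype.card β * p)) ∧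
      (∀ b, ∃ i < Fintype.card β * p, e i = c b) ∧
      ∀ i < Fintype.card β * p, ∀ n, e (ν^[n] i) = f^[n] (e i) := by
  obtain ⟨E, hcard, hmem, hmaps⟩ := h.exists_finset
  have hcE : ∀ b, c b ∈ E := fun b => (hmem _).2 ⟨b, 0, h.pos, rfl⟩
  obtain ⟨e, ν, hbij, hmono, hν, hnext⟩ :=
    exists_enumeration E ⟨_, hcE (Classical.arbitrary β)⟩ hmaps
  rw [hcard] at hbij hmono hν hnext
  set N := Fintype.card β * p
  have hiter : ∀ i < N, ∀ n, e (ν^[n] i) = f^[n] (e i) := fun i hi n => by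
    induction n with
    | zero => rfl
    | succ n ih =>
      rw [Function.iterate_succ_apply', Function.iterate_succ_apply', hnext _ (iterate_lt hν hi n),
        ih]
  have hturnE : ∀ b, ∃ i < N, e i = c b := fun b => hbij.surjOn (hcE b)
  have horbit : ∀ i < N, ∃ b, ∃ n < p, f^[n] (c b) = e i := fun i hi =>
    (hmem _).1 (hbij.mapsTo hi)
  have heI : ∀ i < N, e i ∈ I := fun i hi => by
    obtain ⟨b, n, -, hbn⟩ := horbit i hi
    exact hbn ▸ hI.iterate n (hcI b)
  have hadj : ∀ i, i + 1 < N → ∀ b, c b ≤ e i ∨ e (i + 1) ≤ c b := fun i hi b => by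
    obtain ⟨j, hj, hjb⟩ := hturnE b
    rw [← hjb, hmono.le_iff_le hj (show i < N by omega), hmono.le_iff_le hi hj]
    omega
  have hsucc : ∀ i (hi : i + 1 < N), _ := fun i hi => hstep _ (heI i (by omega)) _ (heI _ hi)
    (hmono (show i < N by omega) hi i.lt_succ_self) (hadj i hi)
  refine ⟨e, ν, ⟨hν, fun i hi => ?_, fun i hi => (hsucc i hi).2, fun i hi => ?_, fun i hi => ?_⟩,
    hmono, hturnE, hiter⟩
  · have hi' : i < N := by omega
    have hlt := (hsucc i hi).1
    rwa [← hnext i hi', ← hnext _ hi, hmono.lt_iff_lt (hν i hi') (hν _ hi),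
      hmono.lt_iff_lt (hν _ hi) (hν i hi')] at hlt
  · obtain ⟨b, n, hn, hbn⟩ := horbit i hi
    refine ⟨p - n, ?_⟩
    rw [Function.comp_apply, hiter i hi, ← hbn, h.iterate_sub hn, hturn]
  · obtain ⟨b, n, -, hbn⟩ := horbit i hi
    obtain ⟨t, ht, htb⟩ := hturnE b
    refine ⟨t, ht, by rw [Function.comp_apply, htb, hturn], n, ?_⟩
    exact hmono.injOn (iterate_lt hν ht n) hi (by rw [hiter t ht, htb, hbn])

end IsPeriodicOrbits

/-! ### Words and periodic sequences -/

section Words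

variable {α : Type}

/-- The concatenation of the word `w` and the sequence `T`. -/
def appendSeq (w : List α) (T : ℕ → α) : ℕ → α := w.foldr consSeq T

lemma appendSeq_nil (T : ℕ → α) : appendSeq [] T = T := rfl

lemma appendSeq_append (u v : List α) (T : ℕ → α) :
    appendSeq (u ++ v) T = appendSeq u (appendSeq v T) := by
  rw [appendSeq, List.foldr_append]; rfl

lemma appendSeq_of_lt (w : List α) (T : ℕ → α) (d : α) {n : ℕ} (hn : n < w.length) :
    appendSeq w T n = w.getD n d := by
  induction w generalizing n with
  | nil => exact absurd hn n.not_lt_zero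
  | cons x w ih =>
    cases n with
    | zero => rfl
    | succ n => exact ih (Nat.lt_of_succ_lt_succ hn)

lemma appendSeq_length_add (w : List α) (T : ℕ → α) (n : ℕ) :
    appendSeq w T (w.length + n) = T n := by
  induction w with
  | nil => rw [List.length_nil, Nat.zero_add, appendSeq_nil]
  | cons x w ih => rw [List.length_cons, Nat.add_right_comm]; exact ih

lemma shift_iterate_appendSeq (w : List α) (T : ℕ → α) : shift^[w.length] (appendSeq w T) = T := by
  funext n
  rw [shift_iterate_apply, Nat.add_comm, appendSeq_length_add]

lemma periodic_of_lt (d : α) {w : List α} {n : ℕ} (hn : n < w.length) :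
    periodic d w n = w[n] := by
  rw [periodic, Nat.mod_eq_of_lt hn, List.getD_eq_getElem _ _ hn]

lemma periodic_add_length (d : α) (w : List α) (n : ℕ) :
    periodic d w (n + w.length) = periodic d w n := by
  rw [periodic, Nat.add_mod_right, periodic]

lemma appendSeq_periodic (d : α) (w : List α) : appendSeq w (periodic d w) = periodic d w := by
  funext n
  rcases lt_or_ge n w.length with hn | hn
  · rw [appendSeq_of_lt w _ d hn, periodic, Nat.mod_eq_of_lt hn]
  · obtain ⟨m, rfl⟩ := Nat.exists_eq_add_of_le hn
    rw [appendSeq_length_add, Nat.add_comm, periodic_add_length]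

lemma eq_periodic {w : List α} (hw : w ≠ []) (d : α) {T : ℕ → α} (h : T = appendSeq w T) :
    T = periodic d w := by
  have hpos : 0 < w.length := List.length_pos_iff.2 hw
  funext n
  induction n using Nat.strong_induction_on with
  | _ n ih =>
    rcases lt_or_ge n w.length with hn | hn
    · rw [h, ← appendSeq_periodic, appendSeq_of_lt _ _ d hn, appendSeq_of_lt _ _ d hn]
    · obtain ⟨m, rfl⟩ := Nat.exists_eq_add_of_le hn
      rw [h, ← appendSeq_periodic, appendSeq_length_add, appendSeq_length_add, ih m (by omega)]

lemma map_range_periodic (d : α) (w : List α) : (List.range w.length).map (periodic d w) = w :=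
  List.ext_getElem (by rw [List.length_map, List.length_range]) fun n h1 h2 => by
    rw [List.getElem_map, List.getElem_range, periodic_of_lt d h2]

end Words

/-! ### Models of unimodal kneading sequences -/

/-- The positions of the orbit of the turning point, when its kneading sequence is `X^∞`. -/
structure IsUModel (X : List USym) (κ : ℕ) (μ : ℕ → ℕ) : Prop
    extends UnimodalModel X.length κ μ where
  two_le : 2 ≤ X.length
  period : μ^[X.length] κ = κ
  itin_eq : consSeq .c (periodic .c X) = itin μ (usym κ) κ

section Unimodal

variable {f : ℝ → ℝ} {c₀ c₁ c₂ x y : ℝ}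

lemma addressU_eq_c : addressU c₁ x = .c ↔ x = c₁ := by
  unfold addressU
  split_ifs with h1 h2
  · simp only [h1.ne]
  all_goals simp only [h2]

lemma addressU_comp {e : ℕ → ℝ} {N κ i : ℕ} (he : StrictMonoOn e (Set.Iio N)) (hκ : κ < N)
    (hi : i < N) : addressU (e κ) (e i) = usym κ i := by
  simp only [addressU, usym, he.lt_iff_lt hi hκ, he.injOn.eq_iff hi hκ]

lemma IsUnimodalMap.step (hf : IsUnimodalMap f c₀ c₁ c₂) (hx : x ∈ Set.Icc c₀ c₂)
    (hy : y ∈ Set.Icc c₀ c₂) (hxy : x < y) (hc : c₁ ≤ x ∨ y ≤ c₁) :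
    (if Ascending (addressU c₁ x) then f x < f y else f y < f x) ∧
      (rank (addressU c₁ x) < rank (addressU c₁ y) ∨
        addressU c₁ x = addressU c₁ y ∧ eps (addressU c₁ x) ≠ 0) := by
  rcases hc with hc | hc
  · have hdesc : ¬ Ascending (addressU c₁ x) := by
      unfold addressU; split_ifs <;> first | linarith | simp [Ascending, rank]
    rw [if_neg hdesc]
    refine ⟨hf.right ⟨hc, hx.2⟩ ⟨hc.trans hxy.le, hy.2⟩ hxy, ?_⟩
    unfold addressU; split_ifs <;> first | linarith | decide
  · have hasc : Ascending (addressU c₁ x) := by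
      unfold addressU; split_ifs <;> first | linarith | simp [Ascending, rank]
    rw [if_pos hasc]
    refine ⟨hf.left ⟨hx.1, hxy.le.trans hc⟩ ⟨hy.1, hc⟩ hxy, ?_⟩
    unfold addressU; split_ifs <;> first | linarith | decide

lemma isPeriodicOrbits_of_addressU {w : List USym} (hw : ∀ x ∈ w, x ≠ .c)
    (had : ∀ n, addressU c₁ (f^[n + 1] c₁) = periodic .c (w ++ [.c]) n) :
    IsPeriodicOrbits f (fun _ : Unit => c₁) id (w ++ [USym.c]).length where
  pos := by simp
  inj _ _ _ := rfl
  inj_perm := Function.injective_id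
  iterate_period _ := by
    have hlast := had w.length
    rw [periodic_of_lt _ (by simp), List.getElem_concat_length rfl, addressU_eq_c] at hlast
    rwa [List.length_append, List.length_singleton]
  not_return _ _ n h0 hn h := by
    obtain ⟨m, rfl⟩ := Nat.exists_eq_add_one_of_ne_zero h0.ne'
    have hm : m < w.length := by simpa using hn
    have hsym := had m
    rw [periodic_of_lt _ (by simp; omega), List.getElem_append_left hm, addressU_eq_c.2 h] at hsym
    exact hw _ (List.getElem_mem hm) hsym.symm

lemma IsUnimodalWord.exists_model {X : List USym} (hX : IsUnimodalWord X) :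
    ∃ κ μ, IsUModel X κ μ := by
  obtain ⟨⟨w, hw0, hw, rfl⟩, f, c₀, c₁, c₂, hf, had⟩ := hX
  have hlen : (w ++ [USym.c]).length = w.length + 1 := by simp
  have hO := isPeriodicOrbits_of_addressU hw had
  obtain ⟨e, μ, hmodel, hmono, hturn, hiter⟩ := hO.exists_isModel hf.mapsTo
    (fun _ => ⟨hf.lt₀₁.le, hf.lt₁₂.le⟩) (ad := addressU c₁)
    (fun _ => by rw [addressU_eq_c.2 rfl]; rfl)
    fun x hx y hy hxy hc => hf.step hx hy hxy (hc ())
  rw [Fintype.card_unit, one_mul] at hmodel hmono hturn hiter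
  obtain ⟨κ, hκ, hκc⟩ := hturn ()
  have hsym : ∀ i < (w ++ [USym.c]).length, usym κ i = (addressU c₁ ∘ e) i := fun i hi => by
    rw [Function.comp_apply, ← hκc, addressU_comp hmono hκ hi]
  refine ⟨κ, μ, { (hmodel.congr_sym hsym) with
    lt := hκ
    two_le := by have := List.length_pos_iff.2 hw0; omega
    period := hmono.injOn (iterate_lt hmodel.maps hκ _) hκ ?_
    itin_eq := ?_ }⟩
  · rw [hiter κ hκ, hκc]
    exact hO.iterate_period ()
  · funext n
    rw [itin, hsym _ (iterate_lt hmodel.maps hκ n), Function.comp_apply, hiter κ hκ, hκc]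
    cases n with
    | zero => exact (addressU_eq_c.2 rfl).symm
    | succ n => exact (had n).symm

end Unimodal

/-! ### Models of symmetric bimodal data -/

/-- The turning symbols; `false` stands for `A` and `true` for `B`. -/
def turnSym (t : Bool) : Sym := if t then .B else .A

/-- The position of the turning point `t`. -/
def turnPos (a b : ℕ) (t : Bool) : ℕ := if t then b else a

namespace SymData

/-- Are both turning points on one orbit? -/
def isDoubly : SymData → Bool
  | .pair _ => false
  | .doubly _ => true

/-- The kneading sequence of the turning point `t`. -/
def seq (V : SymData) (t : Bool) : ℕ → Sym := if t then V.blocks.seqB else V.blocks.seqA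

/-- The word between the turning point `t` and the next turning point of its orbit. -/
def half (V : SymData) (t : Bool) : List Sym := if t then bar V.word else V.word

lemma length_half (V : SymData) (t : Bool) : (V.half t).length = V.word.length := by
  cases t <;> simp [half, bar]

/-- All letters of `P` are symbols of laps. -/
def LapWord (V : SymData) : Prop := ∀ x ∈ V.word, x = .L ∨ x = .M ∨ x = .R

variable {V : SymData}

lemma half_not (V : SymData) (t : Bool) : V.half (!t) = bar (V.half t) := by
  have hconj : conj ∘ conj = id := by funext x; cases x <;> rfl
  cases t <;> simp [half, bar, hconj]

lemma LapWord.half (hV : V.LapWord) (t : Bool) :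
    ∀ x ∈ V.half t, x = .L ∨ x = .M ∨ x = .R := by
  cases t with
  | false => exact hV
  | true =>
    intro x hx
    obtain ⟨y, hy, rfl⟩ := List.mem_map.1 hx
    rcases hV y hy with rfl | rfl | rfl <;> simp [conj]

lemma LapWord.half_ne_turnSym (hV : V.LapWord) (t t' : Bool) : ∀ x ∈ V.half t, x ≠ turnSym t' := by
  intro x hx
  rcases hV.half t x hx with rfl | rfl | rfl <;> cases t' <;> decide

lemma idxOf_B {P : List Sym} (hP : Sym.B ∉ P) (Q : List Sym) :
    (P ++ Sym.B :: Q).idxOf .B = P.length := by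
  rw [List.idxOf_append_of_notMem hP, List.idxOf_cons_self, Nat.add_zero]

lemma LapWord.seq_eq (hV : V.LapWord) (t : Bool) :
    V.seq t = appendSeq (V.half t)
      (consSeq (turnSym (xor t V.isDoubly)) (V.seq (xor t V.isDoubly))) := by
  cases V with
  | pair P =>
    cases t
    · exact (appendSeq_periodic .A (P ++ [.A])).symm.trans (appendSeq_append ..)
    · exact (appendSeq_periodic .B (bar P ++ [.B])).symm.trans (appendSeq_append ..)
  | doubly P =>
    have hB : Sym.B ∉ P := fun h => hV.half_ne_turnSym false true _ h rfl
    have hA : seq (.doubly P) false =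
        appendSeq (P ++ [.B]) (appendSeq (bar P ++ [.A]) (seq (.doubly P) false)) := by
      rw [← appendSeq_append, ← List.append_assoc]
      exact (appendSeq_periodic .A (P ++ [.B] ++ bar P ++ [.A])).symm
    have hshift : seq (.doubly P) true = appendSeq (bar P ++ [.A]) (seq (.doubly P) false) := by
      have hidx : (P ++ [Sym.B] ++ bar P ++ [Sym.A]).idxOf Sym.B = P.length := by
        rw [List.append_assoc, List.append_assoc, List.singleton_append, idxOf_B hB]
      have hseq : seq (.doubly P) true = shift^[(P ++ [Sym.B]).length] (seq (.doubly P) false) := by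
        rw [List.length_append, List.length_singleton, ← hidx]; rfl
      rw [hseq, hA, shift_iterate_appendSeq, ← hA]
    cases t
    · rw [← hshift, appendSeq_append] at hA
      exact hA
    · exact hshift.trans (by rw [appendSeq_append]; rfl)

lemma LapWord.seq_of_lt (hV : V.LapWord) (t : Bool) {n : ℕ} (hn : n < (V.half t).length) :
    V.seq t n = (V.half t)[n] := by
  rw [hV.seq_eq, appendSeq_of_lt _ _ .A hn, List.getD_eq_getElem _ _ hn]

lemma LapWord.seq_ne_turnSym (hV : V.LapWord) (t t' : Bool) {n : ℕ} (hn : n < V.word.length) :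
    V.seq t n ≠ turnSym t' := by
  rw [hV.seq_of_lt t (by rwa [length_half])]
  exact hV.half_ne_turnSym t t' _ (List.getElem_mem _)

lemma LapWord.seq_length (hV : V.LapWord) (t : Bool) :
    V.seq t V.word.length = turnSym (xor t V.isDoubly) := by
  rw [hV.seq_eq, ← length_half V t]
  exact appendSeq_length_add _ _ 0

lemma LapWord.seq_not (hV : V.LapWord) (t : Bool) (n : ℕ) :
    V.seq (!t) n = conj (V.seq t n) := by
  induction n using Nat.strong_induction_on generalizing t with
  | _ n ih =>
    rw [congrFun (hV.seq_eq (!t)) n, congrFun (hV.seq_eq t) n, Bool.not_xor]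
    rcases Nat.lt_or_ge n V.word.length with hn | hn
    · have hlen := V.length_half
      rw [appendSeq_of_lt _ _ .A (by rwa [hlen]), appendSeq_of_lt _ _ .A (by rwa [hlen]), half_not,
        List.getD_eq_getElem _ _ (by rwa [← half_not, hlen]),
        List.getD_eq_getElem _ _ (by rwa [hlen])]
      exact List.getElem_map conj
    · obtain ⟨m, rfl⟩ := Nat.exists_eq_add_of_le hn
      conv_lhs => rw [← V.length_half (!t), appendSeq_length_add]
      conv_rhs => rw [← V.length_half t, appendSeq_length_add]
      cases m with
      | zero => cases xor t V.isDoubly <;> rfl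
      | succ m => exact ih m (by omega) _

end SymData

/-- The positions of the orbits of the turning points, when `V` is the kneading data. -/
structure IsBModel (V : SymData) (a b : ℕ) (ν : ℕ → ℕ) : Prop
    extends BimodalModel (2 * V.p) a b ν where
  lapWord : V.LapWord
  itin_turn : ∀ t, consSeq (turnSym t) (V.seq t) = itin ν (bsym a b) (turnPos a b t)

section Bimodal

variable {f : ℝ → ℝ} {c₀ c₁ c₂ c₃ x y : ℝ}

lemma addressB_eq_turnSym (h₁₂ : c₁ < c₂) {t : Bool} :
    addressB c₁ c₂ x = turnSym t ↔ x = if t then c₂ else c₁ := by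
  unfold addressB
  cases t <;> split_ifs <;> simp_all [turnSym] <;> grind

lemma addressB_comp {e : ℕ → ℝ} {N a b i : ℕ} (he : StrictMonoOn e (Set.Iio N)) (ha : a < N)
    (hb : b < N) (hi : i < N) : addressB (e a) (e b) (e i) = bsym a b i := by
  simp only [addressB, bsym, he.lt_iff_lt hi ha, he.lt_iff_lt hi hb, he.injOn.eq_iff hi ha,
    he.injOn.eq_iff hi hb]

lemma IsBimodalMap.step (hf : IsBimodalMap f c₀ c₁ c₂ c₃) (hx : x ∈ Set.Icc c₀ c₃)
    (hy : y ∈ Set.Icc c₀ c₃) (hxy : x < y) (hc₁ : c₁ ≤ x ∨ y ≤ c₁) (hc₂ : c₂ ≤ x ∨ y ≤ c₂) :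
    (if Ascending (addressB c₁ c₂ x) then f x < f y else f y < f x) ∧
      (rank (addressB c₁ c₂ x) < rank (addressB c₁ c₂ y) ∨
        addressB c₁ c₂ x = addressB c₁ c₂ y ∧ eps (addressB c₁ c₂ x) ≠ 0) := by
  have h₁₂ := hf.lt₁₂
  rcases hc₁ with hc₁ | hc₁
  · rcases hc₂ with hc₂ | hc₂
    · have hasc : Ascending (addressB c₁ c₂ x) := by
        unfold addressB; split_ifs <;> first | linarith | simp [Ascending, rank]
      rw [if_pos hasc]
      refine ⟨hf.right ⟨hc₂, hx.2⟩ ⟨hc₂.trans hxy.le, hy.2⟩ hxy, ?_⟩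
      unfold addressB; split_ifs <;> first | linarith | decide
    · have hdesc : ¬ Ascending (addressB c₁ c₂ x) := by
        unfold addressB; split_ifs <;> first | linarith | simp [Ascending, rank]
      rw [if_neg hdesc]
      refine ⟨hf.middle ⟨hc₁, hxy.le.trans hc₂⟩ ⟨hc₁.trans hxy.le, hc₂⟩ hxy, ?_⟩
      unfold addressB; split_ifs <;> first | linarith | decide
  · have hasc : Ascending (addressB c₁ c₂ x) := by
      unfold addressB; split_ifs <;> first | linarith | simp [Ascending, rank]
    rw [if_pos hasc]
    refine ⟨hf.left ⟨hx.1, hxy.le.trans hc₁⟩ ⟨hy.1, hc₁⟩ hxy, ?_⟩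
    unfold addressB; split_ifs <;> first | linarith | decide

lemma isPeriodicOrbits_of_addressB (h₁₂ : c₁ < c₂) {V : SymData} (hV : V.LapWord)
    (had : ∀ t n, addressB c₁ c₂ (f^[n + 1] (if t then c₂ else c₁)) = V.seq t n) :
    IsPeriodicOrbits f (fun t : Bool => if t then c₂ else c₁) (xor · V.isDoubly) V.p where
  pos := Nat.succ_pos _
  inj s t := by cases s <;> cases t <;> simp [h₁₂.ne, h₁₂.ne']
  inj_perm s t := by simp
  iterate_period t := (addressB_eq_turnSym h₁₂).1 ((had t _).trans (hV.seq_length t))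
  not_return t t' n h0 hn h := by
    obtain ⟨m, rfl⟩ := Nat.exists_eq_add_one_of_ne_zero h0.ne'
    refine hV.seq_ne_turnSym t t' (Nat.lt_of_succ_lt_succ hn) ?_
    rw [← had t m, addressB_eq_turnSym h₁₂, h]

lemma SymData.InD.exists_model {V : SymData} (hV : V.InD) : ∃ a b ν, IsBModel V a b ν := by
  obtain ⟨hlap, f, c₀, c₁, c₂, c₃, hf, hadA, hadB⟩ := hV
  obtain ⟨h₀₁, h₁₂, h₂₃⟩ := And.intro hf.lt₀₁ (And.intro hf.lt₁₂ hf.lt₂₃)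
  have had : ∀ t n, addressB c₁ c₂ (f^[n + 1] (if t then c₂ else c₁)) = V.seq t n := fun t n => by
    cases t
    · exact hadA n
    · exact hadB n
  have hO := isPeriodicOrbits_of_addressB h₁₂ hlap had
  obtain ⟨e, ν, hmodel, hmono, hturn, hiter⟩ := hO.exists_isModel hf.mapsTo
    (fun t => by cases t <;> constructor <;> simp <;> linarith) (ad := addressB c₁ c₂)
    (fun t => by rw [(addressB_eq_turnSym h₁₂).2 rfl]; cases t <;> rfl)
    fun x hx y hy hxy hc => hf.step hx hy hxy (hc false) (hc true)
  rw [Fintype.card_bool] at hmodel hmono hturn hiter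
  obtain ⟨a, ha, rfl : e a = c₁⟩ := hturn false
  obtain ⟨b, hb, rfl : e b = c₂⟩ := hturn true
  have hsym : ∀ i < 2 * V.p, bsym a b i = (addressB (e a) (e b) ∘ e) i := fun i hi =>
    (addressB_comp hmono ha hb hi).symm
  refine ⟨a, b, ν, { (hmodel.congr_sym hsym) with
    ab := (hmono.lt_iff_lt ha hb).1 h₁₂
    bN := hb
    lapWord := hlap
    itin_turn := fun t => ?_ }⟩
  have ht : turnPos a b t < 2 * V.p ∧ e (turnPos a b t) = if t then e b else e a := by
    cases t
    · exact ⟨ha, rfl⟩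
    · exact ⟨hb, rfl⟩
  funext n
  rw [itin, hsym _ (iterate_lt hmodel.maps ht.1 n), Function.comp_apply, hiter _ ht.1, ht.2]
  cases n with
  | zero => exact ((addressB_eq_turnSym h₁₂).2 rfl).symm
  | succ n => exact (had t n).symm

end Bimodal

namespace UnimodalModel

variable {k κ : ℕ} {μ : ℕ → ℕ}

lemma exists_iterate_turn (h : UnimodalModel k κ μ) {y : ℕ} (hy : y < k) : ∃ n, μ^[n] y = κ := by
  simpa only [eps_usym] using h.turn y hy

lemma exists_iterate_eq (h : UnimodalModel k κ μ) {y : ℕ} (hy : y < k) : ∃ n, μ^[n] κ = y := by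
  obtain ⟨t, -, ht, n, hn⟩ := h.cover y hy
  rw [eps_usym] at ht
  exact ⟨n, ht ▸ hn⟩

lemma surj (h : UnimodalModel k κ μ) {y : ℕ} (hy : y < k) : ∃ x < k, μ x = y := by
  obtain ⟨n, rfl⟩ := h.exists_iterate_eq hy
  obtain ⟨m, hm⟩ := h.exists_iterate_turn (h.maps κ h.lt)
  -- `κ` is periodic with period `m + 1`, so `n` may be taken positive.
  refine ⟨μ^[n + m] κ, iterate_lt h.maps h.lt _, ?_⟩
  rw [← Function.iterate_succ_apply' μ, ← Nat.add_succ, Function.iterate_add_apply,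
    Function.iterate_succ_apply, hm]

lemma map_turn (h : UnimodalModel k κ μ) : μ κ = k - 1 := by
  have hκ := h.lt
  have hmaps := h.maps κ hκ
  obtain ⟨x, hx, hμ⟩ := h.surj (y := k - 1) (by omega)
  rcases lt_trichotomy x κ with hlt | rfl | hlt
  · have := h.left hlt le_rfl; omega
  · exact hμ
  · have := h.right le_rfl hlt hx; omega

lemma turn_lt (h : UnimodalModel k κ μ) (hk : 2 ≤ k) : κ < k - 1 := by
  have hκ := h.lt
  by_contra hlt
  have hfix : μ κ = κ := by rw [h.map_turn]; omega
  obtain ⟨n, hn⟩ := h.exists_iterate_eq (y := 0) (by omega)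
  rw [Function.iterate_fixed hfix] at hn
  omega

lemma map_last (h : UnimodalModel k κ μ) (hk : 2 ≤ k) : μ (k - 1) = 0 := by
  have hκ := h.turn_lt hk
  obtain ⟨x, hx, hμ⟩ := h.surj (y := 0) (by omega)
  rcases lt_or_ge κ x with hlt | hle
  · rcases Nat.lt_or_ge x (k - 1) with hx' | hx'
    · have := h.right hlt.le hx' (by omega); omega
    · rwa [show k - 1 = x by omega]
  · rcases Nat.eq_zero_or_pos x with rfl | hpos
    · obtain ⟨n, hn⟩ := h.exists_iterate_turn hx
      rw [Function.iterate_fixed hμ] at hn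
      have := h.map_turn
      rw [← hn, hμ] at this
      omega
    · have := h.left hpos hle; omega

lemma turn_pos (h : UnimodalModel k κ μ) (hk : 3 ≤ k) : 0 < κ := by
  by_contra h0
  obtain rfl : κ = 0 := by omega
  obtain ⟨n, hn⟩ := h.exists_iterate_eq (y := 1) (by omega)
  have hor : ∀ n, μ^[n] 0 = 0 ∨ μ^[n] 0 = k - 1 := by
    intro n
    induction n with
    | zero => exact .inl rfl
    | succ n ih =>
      rw [Function.iterate_succ_apply']
      rcases ih with ih | ih <;> rw [ih]
      · exact .inr h.map_turn
      · exact .inl (h.map_last (by omega))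
  have := hor n
  omega

end UnimodalModel

/-! ### The product of a bimodal and a unimodal model -/

section Lex

variable {k i s j t N : ℕ}

lemma lex_lt (hs : s < k) (ht : t < k) : i * k + s < j * k + t ↔ i < j ∨ i = j ∧ s < t := by
  rcases lt_trichotomy i j with h | rfl | h
  · have : (i + 1) * k ≤ j * k := Nat.mul_le_mul_right k h
    rw [Nat.add_mul] at this
    simp only [h, true_or, iff_true]; omega
  · simp
  · have : (j + 1) * k ≤ i * k := Nat.mul_le_mul_right k h
    rw [Nat.add_mul] at this
    constructor <;> intro <;> omega

lemma lex_le (hs : s < k) (ht : t < k) : i * k + s ≤ j * k + t ↔ i < j ∨ i = j ∧ s ≤ t := by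
  rw [← not_lt, lex_lt ht hs]; omega

lemma lex_eq (hs : s < k) (ht : t < k) : i * k + s = j * k + t ↔ i = j ∧ s = t := by
  have h1 := lex_le (i := i) (j := j) hs ht
  have h2 := lex_le (i := j) (j := i) ht hs
  omega

lemma lex_lt_mul (hs : s < k) : i * k + s < N * k ↔ i < N := by
  have := lex_lt (i := i) (j := N) hs (t := 0) (by omega)
  omega

lemma exists_lex (hk : 0 < k) (x : ℕ) : ∃ i s, s < k ∧ x = i * k + s :=
  ⟨x / k, x % k, Nat.mod_lt _ hk, (Nat.div_add_mod' x k).symm⟩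

end Lex

/-- Reversal of `{0, …, k - 1}` if `r` holds. -/
def rv (k : ℕ) (r : Bool) (s : ℕ) : ℕ := if r then k - 1 - s else s

/-- The map from a group over a point with symbol `x` to the group over its image. -/
def fiberMap (k : ℕ) (μ : ℕ → ℕ) (rev : Bool) (x : Sym) (s : ℕ) : ℕ :=
  match x with
  | .A => μ (rv k rev s)
  | .M => k - 1 - s
  | .B => k - 1 - μ (rv k (!rev) s)
  | _ => s

/-- The product map; position `s` of group `i` is the number `i * k + s`. -/
def prodMap (k a b : ℕ) (ν μ : ℕ → ℕ) (rev : Bool) (x : ℕ) : ℕ :=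
  ν (x / k) * k + fiberMap k μ rev (bsym a b (x / k)) (x % k)

/-- The position over the turning point `t` that corresponds to `y`. -/
def overTurn (k a b : ℕ) (rev t : Bool) (y : ℕ) : ℕ := turnPos a b t * k + rv k (xor t rev) y

/-- The symbols of the positions in the product. -/
abbrev prodSym (k a b κ : ℕ) (rev : Bool) : ℕ → Sym :=
  bsym (overTurn k a b rev false κ) (overTurn k a b rev true κ)

/-- The symbols that replace the turning symbol `t` in the product. -/
def slot (odd t : Bool) (x : USym) : Sym := if t then slotB odd x else slotA odd x

section Product

variable {N a b k κ i s : ℕ} {ν μ : ℕ → ℕ} {rev t : Bool}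

lemma rv_lt (r : Bool) (hs : s < k) : rv k r s < k := by
  unfold rv; split_ifs <;> omega

lemma rv_rv (r r' : Bool) (hs : s < k) : rv k r (rv k r' s) = rv k (xor r r') s := by
  cases r <;> cases r' <;> simp [rv]; omega

lemma exists_rv (r : Bool) (hs : s < k) : ∃ y < k, rv k r y = s :=
  ⟨rv k r s, rv_lt _ hs, by rw [rv_rv _ _ hs, Bool.xor_self]; rfl⟩

lemma turnPos_lt (hV : BimodalModel N a b ν) (t : Bool) : turnPos a b t < N := by
  cases t
  · exact hV.ab.trans hV.bN
  · exact hV.bN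

lemma exists_overTurn (hs : s < k) :
    ∃ y < k, turnPos a b t * k + s = overTurn k a b rev t y := by
  obtain ⟨y, hy, rfl⟩ := exists_rv (xor t rev) hs
  exact ⟨y, hy, rfl⟩

lemma bsym_eq_turnSym (hab : a < b) : bsym a b i = turnSym t ↔ i = turnPos a b t := by
  cases t
  · exact bsym_eq_A
  · exact bsym_eq_B hab

lemma eps_bsym_eq_zero (hab : a < b) : eps (bsym a b i) = 0 ↔ ∃ t, i = turnPos a b t := by
  rw [eps_bsym hab, Bool.exists_bool]; rfl

lemma fiberMap_lap {x : Sym} (hx : x = .L ∨ x = .M ∨ x = .R) (s : ℕ) :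
    fiberMap k μ rev x s = rv k (decide (x = .M)) s := by
  rcases hx with rfl | rfl | rfl <;> rfl

lemma fiberMap_turnSym (t : Bool) (s : ℕ) :
    fiberMap k μ rev (turnSym t) s = rv k t (μ (rv k (xor t rev) s)) := by
  cases t
  · rw [Bool.false_xor]; rfl
  · rw [Bool.true_xor]; rfl

lemma fiberMap_lt (hU : UnimodalModel k κ μ) (x : Sym) (hs : s < k) :
    fiberMap k μ rev x s < k := by
  have h (r : Bool) := hU.maps _ (rv_lt r hs)
  unfold fiberMap
  split
  · exact h rev
  · omega
  · have := h !rev; omega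
  · exact hs

lemma fiberMap_surj (hU : UnimodalModel k κ μ) (x : Sym) (hs : s < k) :
    ∃ s' < k, fiberMap k μ rev x s' = s := by
  have turn (t : Bool) : ∃ s' < k, fiberMap k μ rev (turnSym t) s' = s := by
    obtain ⟨u, hu, rfl⟩ := exists_rv t hs
    obtain ⟨v, hv, rfl⟩ := hU.surj hu
    obtain ⟨w, hw, rfl⟩ := exists_rv (xor t rev) hv
    exact ⟨w, hw, fiberMap_turnSym t w⟩
  cases x with
  | A => exact turn false
  | B => exact turn true
  | M => exact ⟨k - 1 - s, by omega, by simp only [fiberMap]; omega⟩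
  | _ => exact ⟨s, hs, rfl⟩

lemma prodMap_mk (i : ℕ) (hs : s < k) :
    prodMap k a b ν μ rev (i * k + s) = ν i * k + fiberMap k μ rev (bsym a b i) s := by
  have hk : 0 < k := by omega
  have hdiv : (i * k + s) / k = i := by
    rw [Nat.add_comm, Nat.add_mul_div_right _ _ hk, Nat.div_eq_of_lt hs, zero_add]
  have hmod : (i * k + s) % k = s := by
    rw [Nat.add_comm, Nat.add_mul_mod_self_right, Nat.mod_eq_of_lt hs]
  rw [prodMap, hdiv, hmod]

lemma prodMap_overTurn (hab : a < b) (t : Bool) {y : ℕ} (hy : y < k) :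
    prodMap k a b ν μ rev (overTurn k a b rev t y) = ν (turnPos a b t) * k + rv k t (μ y) := by
  rw [overTurn, prodMap_mk _ (rv_lt _ hy), (bsym_eq_turnSym hab).2 rfl, fiberMap_turnSym,
    rv_rv _ _ hy, Bool.xor_self]
  rfl

lemma prodMap_iterate_lex (hU : UnimodalModel k κ μ) (n i : ℕ) (hs : s < k) :
    ∃ s' < k, (prodMap k a b ν μ rev)^[n] (i * k + s) = ν^[n] i * k + s' := by
  induction n with
  | zero => exact ⟨s, hs, rfl⟩
  | succ n ih =>
    obtain ⟨u, hu, h⟩ := ih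
    rw [Function.iterate_succ_apply', Function.iterate_succ_apply', h, prodMap_mk _ hu]
    exact ⟨_, fiberMap_lt hU _ hu, rfl⟩

lemma prodMap_iterate_surj (hU : UnimodalModel k κ μ) (n i : ℕ) (hs : s < k) :
    ∃ s' < k, (prodMap k a b ν μ rev)^[n] (i * k + s') = ν^[n] i * k + s := by
  induction n generalizing s with
  | zero => exact ⟨s, hs, rfl⟩
  | succ n ih =>
    obtain ⟨u, hu, rfl⟩ := fiberMap_surj (rev := rev) hU (bsym a b (ν^[n] i)) hs
    obtain ⟨s', hs', h⟩ := ih hu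
    refine ⟨s', hs', ?_⟩
    rw [Function.iterate_succ_apply', Function.iterate_succ_apply', h, prodMap_mk _ hu]

lemma prodSym_of_lap (hκ : κ < k) (hs : s < k) (hi : ∀ t, i ≠ turnPos a b t) :
    prodSym k a b κ rev (i * k + s) = bsym a b i := by
  have hA : i ≠ a := hi false
  have hB : i ≠ b := hi true
  simp only [prodSym, bsym, overTurn, turnPos, lex_lt hs (rv_lt _ hκ),
    lex_eq hs (rv_lt _ hκ), hA, hB, if_true, if_false, Bool.false_eq_true, false_and, or_false]

lemma prodSym_overTurn (hab : a < b) (hκ : κ < k) (t : Bool) {y : ℕ} (hy : y < k) :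
    prodSym k a b κ rev (overTurn k a b rev t y) = slot rev t (usym κ y) := by
  simp only [prodSym, bsym, overTurn, lex_lt (rv_lt _ hy) (rv_lt _ hκ),
    lex_eq (rv_lt _ hy) (rv_lt _ hκ)]
  cases t
  · simp only [turnPos, Bool.false_xor, hab, hab.ne, lt_irrefl, true_and, false_or, true_or,
      if_true, if_false, Bool.false_eq_true]
    unfold usym
    cases rev <;> simp only [rv] <;> split_ifs <;> simp_all [slot, slotA] <;> omega
  · simp only [turnPos, Bool.true_xor, hab.ne', hab.not_gt, lt_irrefl, true_and, false_and,
      false_or, if_true, if_false, Bool.false_eq_true]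
    unfold usym
    cases rev <;> simp only [rv] <;> split_ifs <;> simp_all [slot, slotB] <;> omega

lemma eps_prodSym (hab : a < b) (hκ : κ < k) (rev t : Bool) :
    eps (prodSym k a b κ rev (overTurn k a b rev t κ)) = 0 := by
  rw [prodSym_overTurn hab hκ t hκ, usym_eq_c.2 rfl]
  cases t <;> rfl

lemma UnimodalModel.step_rv (hU : UnimodalModel k κ μ) (r : Bool) (hs : s + 1 < k) :
    if s < rv k r κ then μ (rv k r s) < μ (rv k r (s + 1))
    else μ (rv k r (s + 1)) < μ (rv k r s) := by
  have hκ := hU.lt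
  cases r <;> simp only [rv, if_true, Bool.false_eq_true, if_false] <;> split_ifs with h
  · exact hU.left (by omega) h
  · exact hU.right (by omega) (by omega) hs
  · exact hU.right (by omega) (by omega) (by omega)
  · exact hU.left (by omega) (by omega)

lemma ascending_prodSym (hab : a < b) (hκ : κ < k) (hs : s < k) :
    Ascending (prodSym k a b κ rev (i * k + s)) ↔
      (i < a ∨ i = a ∧ s < rv k rev κ) ∨ b < i ∨ i = b ∧ rv k (!rev) κ ≤ s := by
  have hlt : overTurn k a b rev false κ < overTurn k a b rev true κ :=
    (lex_lt (rv_lt _ hκ) (rv_lt _ hκ)).2 (.inl hab)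
  rw [ascending_bsym hlt, overTurn, overTurn, lex_lt hs (rv_lt _ hκ), lex_le (rv_lt _ hκ) hs,
    Bool.false_xor, Bool.true_xor, eq_comm (a := turnPos a b true)]
  rfl

lemma fiberMap_step (hab : a < b) (hU : UnimodalModel k κ μ) (i : ℕ) (hs : s + 1 < k) :
    if Ascending (prodSym k a b κ rev (i * k + s))
    then fiberMap k μ rev (bsym a b i) s < fiberMap k μ rev (bsym a b i) (s + 1)
    else fiberMap k μ rev (bsym a b i) (s + 1) < fiberMap k μ rev (bsym a b i) s := by
  simp only [ascending_prodSym hab hU.lt (Nat.lt_of_succ_lt hs)]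
  unfold bsym
  split_ifs with h₁ h₂ h₃ h₄ <;> simp only [fiberMap] <;> try omega
  all_goals
    have hA := hU.step_rv rev hs
    have hB := hU.step_rv (!rev) hs
    have h1 := hU.maps _ (rv_lt (!rev) hs)
    have h2 := hU.maps _ (rv_lt (!rev) (Nat.lt_of_succ_lt hs))
    split_ifs at hA hB <;> omega

lemma prodMap_step (hV : BimodalModel N a b ν) (hU : UnimodalModel k κ μ) {x : ℕ}
    (hx : x + 1 < N * k) :
    if Ascending (prodSym k a b κ rev x)
    then prodMap k a b ν μ rev x < prodMap k a b ν μ rev (x + 1)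
    else prodMap k a b ν μ rev (x + 1) < prodMap k a b ν μ rev x := by
  have hab := hV.ab
  have hκ := hU.lt
  have hlt {i s} := fiberMap_lt (rev := rev) hU (bsym a b i) (s := s)
  obtain ⟨i, s, hs, rfl⟩ := exists_lex (k := k) (by omega) x
  rcases Nat.lt_or_ge (s + 1) k with hs' | hs'
  · have hstep := fiberMap_step (rev := rev) hab hU i hs'
    rw [Nat.add_assoc, prodMap_mk _ hs, prodMap_mk _ hs', Nat.add_lt_add_iff_left,
      Nat.add_lt_add_iff_left]
    exact hstep
  · have hnext : i * k + s + 1 = (i + 1) * k + 0 := by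
      rw [Nat.add_mul, one_mul]; omega
    have hi : i + 1 < N := by rwa [hnext, lex_lt_mul (by omega)] at hx
    have hrv := rv_lt rev hκ
    have hrv' := rv_lt (!rev) hκ
    have hasc : Ascending (prodSym k a b κ rev (i * k + s)) ↔ Ascending (bsym a b i) := by
      rw [ascending_prodSym hab hκ hs, ascending_bsym hab]; omega
    have hstep := hV.step i hi
    simp only [hasc, hnext, prodMap_mk _ hs, prodMap_mk (i + 1) (by omega : 0 < k),
      lex_lt (hlt hs) (hlt (by omega : 0 < k)), lex_lt (hlt (by omega : 0 < k)) (hlt hs)]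
    split_ifs at hstep ⊢
    · exact .inl hstep
    · exact .inl hstep

lemma oddM_cons (x : Sym) (P : List Sym) : oddM (x :: P) = xor (decide (x = .M)) (oddM P) := by
  unfold oddM
  rw [List.count_cons]
  by_cases h : x = .M
  · simp only [h, beq_self_eq_true, if_true, decide_true, Bool.true_xor]
    rw [← decide_not]
    congr 1
    simp only [eq_iff_iff]; omega
  · simp [h]

lemma oddM_bar (P : List Sym) : oddM (bar P) = oddM P := by
  induction P with
  | nil => rfl
  | cons x P ih =>
    change oddM (conj x :: bar P) = _
    rw [oddM_cons, oddM_cons, ih]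
    cases x <;> rfl

/-- Along a word without turning symbols the groups are carried onto each other, preserving or
reversing the order. -/
lemma itin_prodMap_run (hab : a < b) (hκ : κ < k) (P : List Sym)
    (hP : ∀ x ∈ P, x = .L ∨ x = .M ∨ x = .R) (T : ℕ → Sym)
    (hi : itin ν (bsym a b) i = appendSeq P T) (hs : s < k) :
    (prodMap k a b ν μ rev)^[P.length] (i * k + s) = ν^[P.length] i * k + rv k (oddM P) s ∧
      itin (prodMap k a b ν μ rev) (prodSym k a b κ rev) (i * k + s) =
        appendSeq P (itin (prodMap k a b ν μ rev) (prodSym k a b κ rev)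
          (ν^[P.length] i * k + rv k (oddM P) s)) := by
  induction P generalizing i s with
  | nil => exact ⟨rfl, rfl⟩
  | cons x P ih =>
    have hsym : bsym a b i = x := congrFun hi 0
    have hx := hP x List.mem_cons_self
    have hturn : ∀ t, i ≠ turnPos a b t := fun t h => by
      rw [(bsym_eq_turnSym hab).2 h] at hsym
      subst hsym
      revert hx
      cases t <;> decide
    have hstep : prodMap k a b ν μ rev (i * k + s) = ν i * k + rv k (decide (x = .M)) s := by
      rw [prodMap_mk _ hs, hsym, fiberMap_lap hx]
    obtain ⟨hiter, hitin⟩ := ih (fun y hy => hP y (List.mem_cons_of_mem _ hy)) (i := ν i)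
      (congrArg shift hi) (rv_lt (decide (x = .M)) hs)
    rw [rv_rv _ _ hs, Bool.xor_comm, ← oddM_cons] at hiter hitin
    constructor
    · rw [List.length_cons, Function.iterate_succ_apply, hstep, hiter, Function.iterate_succ_apply]
    · rw [itin_eq_consSeq, hstep, hitin, prodSym_of_lap hκ hs hturn, hsym]
      rfl

end Product

lemma SymData.oddM_half (V : SymData) (t : Bool) : oddM (V.half t) = oddM V.word := by
  cases t
  · rfl
  · exact oddM_bar _

/-- The sign of `V`; `true` stands for reversed. -/
def SymData.rev (V : SymData) : Bool := xor (oddM V.word) V.isDoubly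

namespace IsBModel

variable {V : SymData} {a b k κ y : ℕ} {ν μ : ℕ → ℕ}

lemma itin_image (hV : IsBModel V a b ν) (t : Bool) :
    itin ν (bsym a b) (ν (turnPos a b t)) = V.seq t := by
  rw [← shift_itin, ← hV.itin_turn t, shift_consSeq]

lemma iterate_p (hV : IsBModel V a b ν) (t : Bool) :
    ν^[V.p] (turnPos a b t) = turnPos a b (xor t V.isDoubly) :=
  (bsym_eq_turnSym hV.ab).1 <|
    (congrFun (hV.itin_turn t) V.p).symm.trans (hV.lapWord.seq_length t)

lemma prodMap_iterate_p (hV : IsBModel V a b ν) (hU : UnimodalModel k κ μ) (t : Bool)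
    (hy : y < k) :
    (prodMap k a b ν μ V.rev)^[V.p] (overTurn k a b V.rev t y) =
        overTurn k a b V.rev (xor t V.isDoubly) (μ y) ∧
      itin (prodMap k a b ν μ V.rev) (prodSym k a b κ V.rev) (overTurn k a b V.rev t y) =
        consSeq (slot V.rev t (usym κ y)) (appendSeq (V.half t)
          (itin (prodMap k a b ν μ V.rev) (prodSym k a b κ V.rev)
            (overTurn k a b V.rev (xor t V.isDoubly) (μ y)))) := by
  have hμ := hU.maps y hy
  have hrun := itin_prodMap_run (μ := μ) (rev := V.rev) hV.ab hU.lt (V.half t)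
    (hV.lapWord.half t) _ ((hV.itin_image t).trans (hV.lapWord.seq_eq t)) (rv_lt t hμ)
  have hend : ν^[V.word.length] (ν (turnPos a b t)) * k + rv k (oddM V.word) (rv k t (μ y)) =
      overTurn k a b V.rev (xor t V.isDoubly) (μ y) := by
    rw [← Function.iterate_succ_apply, show V.word.length.succ = V.p from rfl, hV.iterate_p,
      rv_rv _ _ hμ, overTurn, SymData.rev]
    congr 2
    cases t <;> cases V.isDoubly <;> cases oddM V.word <;> rfl
  rw [V.length_half, V.oddM_half, hend] at hrun
  constructor
  · rw [SymData.p, Function.iterate_succ_apply, prodMap_overTurn hV.ab t hy, hrun.1]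
  · rw [itin_eq_consSeq, prodSym_overTurn hV.ab hU.lt t hy, prodMap_overTurn hV.ab t hy, hrun.2]

lemma prodMap_iterate_p_iterate (hV : IsBModel V a b ν) (hU : UnimodalModel k κ μ) (t : Bool)
    (hy : y < k) (m : ℕ) :
    (prodMap k a b ν μ V.rev)^[V.p * m] (overTurn k a b V.rev t y) =
      overTurn k a b V.rev ((xor · V.isDoubly)^[m] t) (μ^[m] y) := by
  induction m with
  | zero => rfl
  | succ m ih =>
    rw [Nat.mul_succ, Nat.add_comm, Function.iterate_add_apply, ih,
      (hV.prodMap_iterate_p hU _ (iterate_lt hU.maps hy m)).1, Function.iterate_succ_apply',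
      Function.iterate_succ_apply']

lemma prod_model (hV : IsBModel V a b ν) (hU : UnimodalModel k κ μ) :
    BimodalModel (2 * V.p * k) (overTurn k a b V.rev false κ) (overTurn k a b V.rev true κ)
      (prodMap k a b ν μ V.rev) where
  ab := (lex_lt (rv_lt _ hU.lt) (rv_lt _ hU.lt)).2 (.inl hV.ab)
  bN := (lex_lt_mul (rv_lt _ hU.lt)).2 hV.bN
  maps x hx := by
    obtain ⟨i, s, hs, rfl⟩ := exists_lex (Nat.zero_lt_of_lt hU.lt) x
    rw [prodMap_mk _ hs, lex_lt_mul (fiberMap_lt hU _ hs)]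
    exact hV.maps i ((lex_lt_mul hs).1 hx)
  step x hx := prodMap_step hV.toBimodalModel hU hx
  mono x _ := bsym_mono _ _ x
  turn x hx := by
    obtain ⟨i, s, hs, rfl⟩ := exists_lex (Nat.zero_lt_of_lt hU.lt) x
    obtain ⟨n, hn⟩ := hV.turn i ((lex_lt_mul hs).1 hx)
    obtain ⟨t, ht⟩ := (eps_bsym_eq_zero hV.ab).1 hn
    obtain ⟨s', hs', h⟩ := prodMap_iterate_lex (a := a) (b := b) (ν := ν) (rev := V.rev) hU n i hs
    obtain ⟨y, hy, hsy⟩ := exists_overTurn (a := a) (b := b) (rev := V.rev) (t := t) hs'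
    obtain ⟨m, hm⟩ := hU.exists_iterate_turn hy
    refine ⟨V.p * m + n, ?_⟩
    rw [Function.iterate_add_apply, h, ht, hsy, hV.prodMap_iterate_p_iterate hU t hy m, hm]
    exact eps_prodSym hV.ab hU.lt _ _
  cover x hx := by
    obtain ⟨i, s, hs, rfl⟩ := exists_lex (Nat.zero_lt_of_lt hU.lt) x
    obtain ⟨j, -, hj, n, rfl⟩ := hV.cover i ((lex_lt_mul hs).1 hx)
    obtain ⟨t, rfl⟩ := (eps_bsym_eq_zero hV.ab).1 hj
    obtain ⟨s', hs', h⟩ := prodMap_iterate_surj (a := a) (b := b) (ν := ν) (rev := V.rev) hU n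
      (turnPos a b t) hs
    obtain ⟨y, hy, hsy⟩ := exists_overTurn (a := a) (b := b) (rev := V.rev) (t := t) hs'
    obtain ⟨m, rfl⟩ := hU.exists_iterate_eq hy
    have hsurj : Function.Surjective (xor · V.isDoubly) := fun t => ⟨xor t V.isDoubly, by simp⟩
    obtain ⟨t', rfl⟩ := hsurj.iterate m t
    refine ⟨overTurn k a b V.rev t' κ, ?_, eps_prodSym hV.ab hU.lt _ _, n + V.p * m, ?_⟩
    · exact (lex_lt_mul (rv_lt _ hU.lt)).2 (turnPos_lt hV.toBimodalModel t')
    · rw [Function.iterate_add_apply, hV.prodMap_iterate_p_iterate hU t' hU.lt m, ← hsy, h]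

end IsBModel

/-! ### Words of the star product -/

section Words

variable {α : Type}

lemma mem_of_periodic_eq {d x : α} {w : List α} {n : ℕ} (hx : x ≠ d) (h : periodic d w n = x) :
    x ∈ w := by
  rw [periodic] at h
  rcases lt_or_ge (n % w.length) w.length with hn | hn
  · rw [← h, List.getD_eq_getElem _ _ hn]
    exact List.getElem_mem hn
  · exact absurd (h.symm.trans (List.getD_eq_default _ _ hn)) hx

lemma shift_periodic (d : α) {w : List α} (hw : w ≠ []) :
    shift (periodic d w) = periodic d (w.rotate 1) := by
  obtain ⟨x, w, rfl⟩ := List.exists_cons_of_ne_nil hw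
  have hcons : shift (periodic d (x :: w)) = appendSeq w (periodic d (x :: w)) :=
    congrArg shift (appendSeq_periodic d (x :: w)).symm
  rw [List.rotate_cons_succ, List.rotate_zero]
  refine eq_periodic (by simp) d ?_
  rw [appendSeq_append, hcons]
  exact congrArg (appendSeq w) (appendSeq_periodic d (x :: w)).symm

lemma eq_periodic_flatMap_range (d : α) {T : ℕ → ℕ → α} {F : ℕ → List α}
    (h : ∀ m, T m = appendSeq (F m) (T (m + 1))) (hF : F 0 ≠ []) {n : ℕ} (hn : 0 < n)
    (hT : T n = T 0) : T 0 = periodic d ((List.range n).flatMap F) := by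
  have happend : ∀ n, T 0 = appendSeq ((List.range n).flatMap F) (T n) := by
    intro n
    induction n with
    | zero => rfl
    | succ n ih =>
      rw [List.range_succ, List.flatMap_append, appendSeq_append, List.flatMap_singleton, ← h, ← ih]
  refine eq_periodic (fun h0 => hF ?_) d ((happend n).trans (by rw [hT]))
  exact List.flatMap_eq_nil_iff.1 h0 0 (List.mem_range.2 hn)

lemma rotate_map_range {h : ℕ → α} {n : ℕ} (hper : Function.Periodic h n) (m : ℕ) :
    ((List.range n).map h).rotate m = (List.range n).map fun i => h (i + m) := by
  refine List.ext_getElem (by simp) fun i h1 h2 => ?_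
  simp only [List.getElem_rotate, List.getElem_map, List.getElem_range, List.length_map,
    List.length_range, hper.map_mod_nat]

lemma map_range_append_self {h : ℕ → α} {n : ℕ} (hper : Function.Periodic h n) :
    (List.range n).map h ++ (List.range n).map h = (List.range (2 * n)).map h := by
  rw [two_mul, List.range_add, List.map_append, List.map_map]
  refine congrArg _ (List.map_congr_left fun i _ => ?_)
  rw [Function.comp_apply, Nat.add_comm, hper]

end Words

lemma translate_map_range (h : ℕ → USym) (n : ℕ) :
    translate ((List.range (2 * n)).map h) =
      (List.range n).map fun i => pairCode (h (2 * i)) (h (2 * i + 1)) := by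
  induction n generalizing h with
  | zero => rfl
  | succ n ih =>
    rw [show 2 * (n + 1) = 2 * n + 1 + 1 by ring, List.range_succ_eq_map, List.range_succ_eq_map,
      List.range_succ_eq_map]
    simp only [List.map_cons, List.map_map, translate]
    exact congrArg _ (ih fun i => h (i + 2))

lemma slots_pairCode (o : Bool) {x y : USym} (h : x = .c → y = .r) :
    slots o (pairCode x y) = (slotB (!o) x, slotA (!o) y) := by
  cases x <;> cases y <;> cases o <;> simp_all [slots, pairCode, slotA, slotB]

namespace IsUModel

variable {X : List USym} {κ : ℕ} {μ : ℕ → ℕ}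

lemma iterate_add_length (h : IsUModel X κ μ) (n : ℕ) : μ^[n + X.length] κ = μ^[n] κ := by
  rw [Function.iterate_add_apply, h.period]

lemma iterate_add_double (h : IsUModel X κ μ) {n : ℕ} (hn : X.length ∣ 2 * n) (i m : ℕ) :
    μ^[2 * (i + n) + m] κ = μ^[2 * i + m] κ := by
  obtain ⟨l, hl⟩ := hn
  have hper : μ^[2 * n] κ = κ := by
    rw [hl, Function.iterate_mul, Function.iterate_fixed h.period]
  rw [show 2 * (i + n) + m = 2 * i + m + 2 * n by ring, Function.iterate_add_apply, hper]

lemma periodic_apply (h : IsUModel X κ μ) (n : ℕ) :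
    periodic .c X n = usym κ (μ^[n + 1] κ) := congrFun h.itin_eq (n + 1)

lemma eq_map_range (h : IsUModel X κ μ) :
    X = (List.range X.length).map fun n => usym κ (μ^[n + 1] κ) := by
  conv_lhs => rw [← map_range_periodic .c X]
  exact List.map_congr_left fun n _ => h.periodic_apply n

lemma periodic_usym (h : IsUModel X κ μ) (m : ℕ) :
    Function.Periodic (fun n => usym κ (μ^[n + m] κ)) X.length := fun n => by
  simp only [Nat.add_right_comm n X.length m, h.iterate_add_length]

lemma translate_append_self (h : IsUModel X κ μ) :
    translate (X ++ X) = (List.range X.length).map fun i =>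
      pairCode (usym κ (μ^[2 * i + 1] κ)) (usym κ (μ^[2 * i + 2] κ)) := by
  rw [h.eq_map_range, map_range_append_self (h.periodic_usym 1), translate_map_range,
    ← h.eq_map_range]

lemma translate_even (h : IsUModel X κ μ) {n : ℕ} (hn : X.length = 2 * n) :
    translate X = (List.range n).map fun i =>
      pairCode (usym κ (μ^[2 * i + 1] κ)) (usym κ (μ^[2 * i + 2] κ)) := by
  rw [h.eq_map_range, hn, translate_map_range]

lemma translate_rotate (h : IsUModel X κ μ) {n : ℕ} (hn : X.length = 2 * n) :
    translate (X.rotate 1) = (List.range n).map fun i =>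
      pairCode (usym κ (μ^[2 * i + 2] κ)) (usym κ (μ^[2 * i + 3] κ)) := by
  rw [h.eq_map_range, rotate_map_range (h.periodic_usym 1), hn, translate_map_range]

lemma rotate_translate_rotate (h : IsUModel X κ μ) {n : ℕ} (hn : X.length = 2 * n) :
    (translate (X.rotate 1)).rotate ((translate (X.rotate 1)).length - 1) =
      (List.range n).map fun i => pairCode (usym κ (μ^[2 * i] κ)) (usym κ (μ^[2 * i + 1] κ)) := by
  have hadd := h.iterate_add_double (n := n) (by rw [hn])
  have hper : Function.Periodic (fun i =>
      pairCode (usym κ (μ^[2 * i + 2] κ)) (usym κ (μ^[2 * i + 3] κ))) n := fun i => by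
    simp only [hadd]
  rw [h.translate_rotate hn, rotate_map_range hper, List.length_map, List.length_range]
  refine List.map_congr_left fun i hi => ?_
  have hn' : 0 < n := Nat.zero_lt_of_lt (List.mem_range.1 hi)
  rw [show 2 * (i + (n - 1)) + 2 = 2 * (i + n) + 0 by omega,
    show 2 * (i + (n - 1)) + 3 = 2 * (i + n) + 1 by omega, hadd, hadd, Nat.add_zero]

lemma usym_succ_of_eq_c (h : IsUModel X κ μ) {n : ℕ} (hn : usym κ (μ^[n] κ) = .c) :
    usym κ (μ^[n + 1] κ) = .r := by
  rw [Function.iterate_succ_apply', usym_eq_c.1 hn, usym_eq_r, h.map_turn]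
  exact h.turn_lt h.two_le

lemma slots_pairCode_iterate (h : IsUModel X κ μ) (o : Bool) (n : ℕ) :
    slots o (pairCode (usym κ (μ^[n] κ)) (usym κ (μ^[n + 1] κ))) =
      (slotB (!o) (usym κ (μ^[n] κ)), slotA (!o) (usym κ (μ^[n + 1] κ))) :=
  slots_pairCode o h.usym_succ_of_eq_c

end IsUModel

/-- On a doubly stable orbit the kneading sequence of `B` is a shift of the one of `A`. -/
lemma itin_idxOf {ν : ℕ → ℕ} {sy : ℕ → Sym} {a b : ℕ} (hab : a ≠ b)
    (hB : ∀ i, sy i = .B ↔ i = b) {w : List Sym}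
    (hA : consSeq .A (periodic .A w) = itin ν sy a) (hr : ∃ n, ν^[n] a = b) :
    consSeq .B (shift^[w.idxOf .B + 1] (periodic .A w)) = itin ν sy b := by
  have hw : periodic .A w = itin ν sy (ν a) := by
    rw [← shift_itin, ← hA, shift_consSeq]
  have hmem : Sym.B ∈ w := by
    obtain ⟨n, hn⟩ := hr
    cases n with
    | zero => exact absurd hn hab
    | succ n => exact mem_of_periodic_eq (by decide) ((congrFun hw n).trans ((hB _).2 hn))
  have hb : ν^[w.idxOf .B] (ν a) = b := by
    have hidx := congrFun hw (w.idxOf .B)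
    rw [periodic_of_lt _ (List.idxOf_lt_length_of_mem hmem), List.getElem_idxOf] at hidx
    exact (hB _).1 hidx.symm
  rw [hw, shift_iterate_itin, Function.iterate_succ_apply', hb, itin_eq_consSeq ν _ b,
    (hB b).2 rfl]

/-- The itinerary of the `m`-th point of the orbit of `κ`, seen over the turning point `t`. -/
def prodSeq (V : SymData) (k a b κ : ℕ) (ν μ : ℕ → ℕ) (t : Bool) (m : ℕ) : ℕ → Sym :=
  itin (prodMap k a b ν μ V.rev) (prodSym k a b κ V.rev) (overTurn k a b V.rev t (μ^[m] κ))

section Star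

variable {V : SymData} {X : List USym} {P : List Sym} {a b k κ n : ℕ} {ν μ : ℕ → ℕ}

lemma prodSeq_eq (hV : IsBModel V a b ν) (hU : UnimodalModel k κ μ) (t : Bool) (m : ℕ) :
    prodSeq V k a b κ ν μ t m = appendSeq (slot V.rev t (usym κ (μ^[m] κ)) :: V.half t)
      (prodSeq V k a b κ ν μ (xor t V.isDoubly) (m + 1)) := by
  rw [prodSeq, (hV.prodMap_iterate_p hU t (iterate_lt hU.maps hU.lt m)).2,
    ← Function.iterate_succ_apply' μ]
  rfl

lemma shift_prodSeq (hV : IsBModel V a b ν) (hU : UnimodalModel k κ μ) (t : Bool) (m : ℕ) :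
    shift (prodSeq V k a b κ ν μ t m) =
      appendSeq (V.half t ++ [slot V.rev (xor t V.isDoubly) (usym κ (μ^[m + 1] κ))])
        (shift (prodSeq V k a b κ ν μ (xor t V.isDoubly) (m + 1))) := by
  rw [appendSeq_append, prodSeq_eq hV hU t m, prodSeq_eq hV hU _ (m + 1)]
  rfl

lemma consSeq_shift_prodSeq (hV : IsBModel V a b ν) (hU : UnimodalModel k κ μ) (t : Bool) :
    consSeq (turnSym t) (shift (prodSeq V k a b κ ν μ t 0)) =
      itin (prodMap k a b ν μ V.rev) (prodSym k a b κ V.rev) (overTurn k a b V.rev t κ) := by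
  have hsym : turnSym t = prodSeq V k a b κ ν μ t 0 0 := by
    rw [prodSeq_eq hV hU, Function.iterate_zero_apply, usym_eq_c.2 rfl]
    cases t <;> rfl
  rw [hsym, consSeq_shift]
  rfl

lemma markovB_of_seq (hV : IsBModel V a b ν) (hU : UnimodalModel k κ μ) {S : BlockData}
    (hA : S.seqA = shift (prodSeq V k a b κ ν μ false 0))
    (hB : S.seqB = shift (prodSeq V k a b κ ν μ true 0)) :
    S.markovB = matOf (2 * V.p * k) (prodMap k a b ν μ V.rev) := by
  rw [BlockData.markovB, hA, hB]
  exact (hV.prod_model hU).markov_eq (consSeq_shift_prodSeq hV hU false)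
    (consSeq_shift_prodSeq hV hU true)

lemma shift_prodSeq_pair (hV : IsBModel (.pair P) a b ν) (hX : IsUModel X κ μ) (d : Sym)
    (t : Bool) :
    shift (prodSeq (.pair P) X.length a b κ ν μ t 0) =
      periodic d (X.flatMap fun x => (SymData.pair P).half t ++ [slot (oddM P) t x]) := by
  have hrev : (SymData.pair P).rev = oddM P := Bool.xor_false _
  conv_rhs => rw [hX.eq_map_range, List.flatMap_map]
  refine eq_periodic_flatMap_range d
    (T := fun m => shift (prodSeq (.pair P) X.length a b κ ν μ t m)) (fun m => ?_) (by simp)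
    (Nat.zero_lt_of_lt hX.lt) ?_
  · have hstep := shift_prodSeq hV hX.toUnimodalModel t m
    rwa [hrev, SymData.isDoubly, Bool.xor_false] at hstep
  · simp only [prodSeq, hX.period, Function.iterate_zero_apply]

lemma markovB_pair (hV : IsBModel (.pair P) a b ν) (hX : IsUModel X κ μ) :
    (BlockData.pair (X.flatMap fun x => P ++ [slotA (oddM P) x])
      (X.flatMap fun x => bar P ++ [slotB (oddM (bar P)) x])).markovB =
    matOf (2 * (SymData.pair P).p * X.length)
      (prodMap X.length a b ν μ (SymData.pair P).rev) := by
  rw [oddM_bar]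
  exact markovB_of_seq hV hX.toUnimodalModel (shift_prodSeq_pair hV hX .A false).symm
    (shift_prodSeq_pair hV hX .B true).symm

lemma rev_doubly (P : List Sym) : (SymData.doubly P).rev = !oddM P := Bool.xor_true _

lemma shift_prodSeq_doubly (hV : IsBModel (.doubly P) a b ν) (hX : IsUModel X κ μ) (hn : 0 < n)
    (hper : μ^[2 * n] κ = κ) :
    shift (prodSeq (.doubly P) X.length a b κ ν μ false 0) =
      periodic .A (starWord P ((List.range n).map fun i =>
        pairCode (usym κ (μ^[2 * i + 1] κ)) (usym κ (μ^[2 * i + 2] κ)))) := by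
  rw [starWord, List.flatMap_map]
  refine eq_periodic_flatMap_range .A
    (T := fun m => shift (prodSeq (.doubly P) X.length a b κ ν μ false (2 * m))) (fun m => ?_)
    (by simp) hn ?_
  · rw [hX.slots_pairCode_iterate, ← rev_doubly, List.append_assoc, appendSeq_append,
      shift_prodSeq hV hX.toUnimodalModel, shift_prodSeq hV hX.toUnimodalModel]
    rfl
  · simp only [prodSeq, hper, Nat.mul_zero, Function.iterate_zero_apply]

lemma markovB_doubly_minus (hV : IsBModel (.doubly P) a b ν) (hX : IsUModel X κ μ)
    (hodd : Odd X.length) :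
    (BlockData.doubly (starWord P (translate (X ++ X)))).markovB =
    matOf (2 * (SymData.doubly P).p * X.length)
      (prodMap X.length a b ν μ (SymData.doubly P).rev) := by
  have hprod := hV.prod_model hX.toUnimodalModel
  have hA := shift_prodSeq_doubly hV hX (Nat.zero_lt_of_lt hX.lt)
    (by rw [two_mul, hX.iterate_add_length, hX.period])
  rw [← hX.translate_append_self] at hA
  -- As `k` is odd, `k` steps of length `p` lead from one turning point to the other.
  have hreach := hV.prodMap_iterate_p_iterate hX.toUnimodalModel false hX.lt X.length
  have hinv : Function.Involutive (xor · true) := fun t => by simp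
  rw [SymData.isDoubly, hinv.iterate_odd hodd, hX.period] at hreach
  have hB := itin_idxOf hprod.ab.ne (fun _ => bsym_eq_B hprod.ab)
    ((congrArg _ hA.symm).trans (consSeq_shift_prodSeq hV hX.toUnimodalModel false)) ⟨_, hreach⟩
  exact markovB_of_seq (S := .doubly _) hV hX.toUnimodalModel hA.symm (congrArg shift hB)

lemma prodSeq_doubly (hV : IsBModel (.doubly P) a b ν) (hX : IsUModel X κ μ) (hn : 0 < n)
    (hper : μ^[2 * n] κ = κ) :
    prodSeq (.doubly P) X.length a b κ ν μ true 0 =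
      periodic .B (starWord' P ((List.range n).map fun i =>
        pairCode (usym κ (μ^[2 * i] κ)) (usym κ (μ^[2 * i + 1] κ)))) := by
  rw [starWord', List.flatMap_map]
  refine eq_periodic_flatMap_range .B
    (T := fun m => prodSeq (.doubly P) X.length a b κ ν μ true (2 * m)) (fun m => ?_)
    (by simp) hn ?_
  · rw [hX.slots_pairCode_iterate, ← rev_doubly, List.append_assoc, appendSeq_append,
      prodSeq_eq hV hX.toUnimodalModel, prodSeq_eq hV hX.toUnimodalModel]
    rfl
  · simp only [prodSeq, hper, Nat.mul_zero, Function.iterate_zero_apply]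

lemma markovB_doubly_plus (hV : IsBModel (.doubly P) a b ν) (hX : IsUModel X κ μ)
    (heven : Even X.length) :
    (BlockData.pair (starWord P (translate X)) ((starWord' P ((translate (X.rotate 1)).rotate
      ((translate (X.rotate 1)).length - 1))).rotate 1)).markovB =
    matOf (2 * (SymData.doubly P).p * X.length)
      (prodMap X.length a b ν μ (SymData.doubly P).rev) := by
  obtain ⟨n, hn⟩ := even_iff_exists_two_mul.1 heven
  have hpos : 0 < n := by have := hX.two_le; omega
  have hper : μ^[2 * n] κ = κ := hn ▸ hX.period
  have hne : starWord' P ((List.range n).map fun i =>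
      pairCode (usym κ (μ^[2 * i] κ)) (usym κ (μ^[2 * i + 1] κ))) ≠ [] := fun h => by
    simpa using List.flatMap_eq_nil_iff.1 h _
      (List.mem_map_of_mem (List.mem_range.2 hpos))
  rw [hX.translate_even hn, hX.rotate_translate_rotate hn]
  refine markovB_of_seq (S := .pair _ _) hV hX.toUnimodalModel
    (shift_prodSeq_doubly hV hX hpos hper).symm ?_
  rw [prodSeq_doubly hV hX hpos hper, shift_periodic _ hne]
  rfl

theorem markovB_star (hV : IsBModel V a b ν) (hX : IsUModel X κ μ) {W : Factor} (hW : W.Over X)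
    {S : BlockData} (hS : star V W = some S) :
    S.markovB = matOf (2 * V.p * X.length) (prodMap X.length a b ν μ V.rev) := by
  cases V <;> cases hW <;> cases hS
  case pair.twin => exact markovB_pair hV hX
  case doubly.minus h => exact markovB_doubly_minus hV hX h
  case doubly.plus h => exact markovB_doubly_plus hV hX h

end Star

/-! ### The block matrix is the matrix of the product model -/

section Block

variable {N a b k κ i j s t : ℕ} {ν μ : ℕ → ℕ} {π : BlockPattern}

lemma sum_btw_Ico {f : ℕ → ℕ} {m n : ℕ} (hmn : m ≤ n)
    (hf : MonotoneOn f (Set.Icc m n) ∨ AntitoneOn f (Set.Icc m n)) (t : ℕ) :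
    ∑ s ∈ Finset.Ico m n, (if Btw (f s) (f (s + 1)) t then 1 else 0) =
      if Btw (f m) (f n) t then 1 else 0 := by
  induction n, hmn using Nat.le_induction with
  | base => rw [Finset.Ico_self, Finset.sum_empty, if_neg]; unfold Btw; omega
  | succ n hmn ih =>
    have hsub : Set.Icc m n ⊆ Set.Icc m (n + 1) := Set.Icc_subset_Icc_right n.le_succ
    have hord : f m ≤ f n ∧ f n ≤ f (n + 1) ∨ f n ≤ f m ∧ f (n + 1) ≤ f n := by
      have h0 : m ∈ Set.Icc m (n + 1) := ⟨le_rfl, by omega⟩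
      have h1 : n ∈ Set.Icc m (n + 1) := ⟨hmn, n.le_succ⟩
      have h2 : n + 1 ∈ Set.Icc m (n + 1) := ⟨by omega, le_rfl⟩
      exact hf.imp (fun h => ⟨h h0 h1 hmn, h h1 h2 n.le_succ⟩)
        fun h => ⟨h h0 h1 hmn, h h1 h2 n.le_succ⟩
    rw [Finset.sum_Ico_succ_top hmn, ih (hf.imp (·.mono hsub) (·.mono hsub))]
    split_ifs <;> unfold Btw at * <;> omega

lemma single_matOf (hU : UnimodalModel k κ μ) (hk : 2 ≤ k) (ht : t < k - 1) :
    single (matOf k μ) t = true ↔ t < μ 0 := by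
  have hκ := hU.turn_lt hk
  have hsum : ∑ s ∈ Finset.range (k - 1), entry (matOf k μ) s t =
      (if Btw (μ 0) (μ κ) t then 1 else 0) + if Btw (μ κ) (μ (k - 1)) t then 1 else 0 := by
    have hleft : StrictMonoOn μ (Set.Icc 0 κ) := fun i _ j hj hij => hU.left hij hj.2
    have hright : StrictAntiOn μ (Set.Icc κ (k - 1)) := fun i hi j hj hij =>
      hU.right hi.1 hij (by have := hj.2; omega)
    rw [← sum_btw_Ico κ.zero_le (.inl hleft.monotoneOn),
      ← sum_btw_Ico hκ.le (.inr hright.antitoneOn),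
      Finset.sum_Ico_consecutive _ κ.zero_le hκ.le, ← Finset.range_eq_Ico]
    refine Finset.sum_congr rfl fun s hs => ?_
    rw [Finset.mem_range] at hs
    simp only [entry_matOf hU.maps, show s + 1 < k by omega, true_and]
  rw [single, decide_eq_true_iff]
  change ∑ s ∈ Finset.range (k - 1), entry (matOf k μ) s t = 1 ↔ _
  rw [hsum, hU.map_turn, hU.map_last hk]
  split_ifs <;> unfold Btw at * <;> omega

lemma innerBlock_matOf (hU : UnimodalModel k κ μ) (hs : s + 1 < k) (ht : t + 1 < k) :
    innerBlock π (matOf k μ) i s t =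
      if Btw (fiberMap k μ π.rev (π.sym i) s) (fiberMap k μ π.rev (π.sym i) (s + 1)) t
      then 1 else 0 := by
  have hsize : (matOf k μ).1 = k - 1 := rfl
  have h1 (r : Bool) := hU.maps _ (rv_lt r (show s < k by omega))
  have h2 (r : Bool) := hU.maps _ (rv_lt r hs)
  have hrow : k - 1 - 1 - s + 1 = k - 1 - s := by omega
  have hrow' : k - 1 - (s + 1) = k - 1 - 1 - s := by omega
  cases hx : π.sym i <;> simp only [innerBlock, hx, fiberMap, hsize, entry_matOf hU.maps] <;>
    refine if_congr ?_ rfl rfl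
  case A =>
    cases π.rev <;> simp only [rv, if_true, if_false, Bool.false_eq_true, hrow, hrow', hs]
    · rw [true_and]
    · unfold Btw; omega
  case B =>
    have h1 := h1 !π.rev
    have h2 := h2 !π.rev
    cases hr : π.rev <;> simp only [hr, rv, Bool.not_false, Bool.not_true, if_true, if_false,
      Bool.false_eq_true, hrow, hrow'] at h1 h2 ⊢ <;> unfold Btw <;> omega
  all_goals unfold Btw; omega

lemma contEntry_right (hab : a < b) (hU : UnimodalModel k κ μ) (hk : 2 ≤ k)
    (hsym : π.sym i = bsym a b i) (ht : t + 1 < k) :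
    contEntry π (matOf k μ) i true t = true ↔
      if i < a ∨ b ≤ i then fiberMap k μ π.rev (bsym a b i) (k - 1) ≤ t
      else t < fiberMap k μ π.rev (bsym a b i) (k - 1) := by
  have hsize : (matOf k μ).1 = k - 1 := rfl
  have := hU.maps 0 (by omega)
  have hlast := hU.map_last hk
  have hA := single_matOf hU hk (show t < k - 1 by omega)
  have hB := single_matOf hU hk (show k - 1 - 1 - t < k - 1 by omega)
  simp only [contEntry, hsym, hsize, bsym]
  split_ifs <;> simp only [fiberMap, Bool.and_eq_true, beq_iff_eq, hA, hB] <;> try omega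
  all_goals cases π.rev <;> simp [rv, hlast] <;> omega

lemma contEntry_left (hab : a < b) (hU : UnimodalModel k κ μ) (hk : 2 ≤ k)
    (hsym : π.sym i = bsym a b i) (ht : t + 1 < k) :
    contEntry π (matOf k μ) i false t = true ↔
      if i ≤ a ∨ b < i then t < fiberMap k μ π.rev (bsym a b i) 0
      else fiberMap k μ π.rev (bsym a b i) 0 ≤ t := by
  have hsize : (matOf k μ).1 = k - 1 := rfl
  have := hU.maps 0 (by omega)
  have hlast := hU.map_last hk
  have hA := single_matOf hU hk (show t < k - 1 by omega)
  have hB := single_matOf hU hk (show k - 1 - 1 - t < k - 1 by omega)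
  simp only [contEntry, hsym, hsize, bsym]
  split_ifs <;> simp only [fiberMap, Bool.and_eq_true, beq_iff_eq, hA, hB] <;> try omega
  all_goals cases π.rev <;> simp [rv, hlast] <;> omega

lemma entry_blockProduct (A B : SqMat) (hs : s < B.1 + 1)
    (ht : t < B.1 + 1) (hx : i * (B.1 + 1) + s < (A.1 + 1) * (B.1 + 1) - 1)
    (hy : j * (B.1 + 1) + t < (A.1 + 1) * (B.1 + 1) - 1) :
    entry (blockProduct A π B) (i * (B.1 + 1) + s) (j * (B.1 + 1) + t) =
      if s < B.1 then if t < B.1 ∧ j = π.next i then innerBlock π B i s t else 0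
      else if t < B.1 then
        if (if j = 0 then 0 else entry A i (j - 1)) = entry A i j then
          (if j = 0 then 0 else entry A i (j - 1))
        else if (j = π.next i ∧ contEntry π B i true t) ∨
          (j = π.next (i + 1) ∧ contEntry π B (i + 1) false t) then 1 else 0
      else entry A i j := by
  have hdiv {i s} (hs : s < B.1 + 1) : (i * (B.1 + 1) + s) / (B.1 + 1) = i := by
    rw [Nat.add_comm, Nat.add_mul_div_right _ _ (Nat.succ_pos _), Nat.div_eq_of_lt hs, zero_add]
  have hmod {i s} (hs : s < B.1 + 1) : (i * (B.1 + 1) + s) % (B.1 + 1) = s := by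
    rw [Nat.add_comm, Nat.add_mul_mod_self_right, Nat.mod_eq_of_lt hs]
  refine (dif_pos ⟨hx, hy⟩).trans ?_
  simp only [blockProduct, Matrix.of_apply, hdiv hs, hdiv ht, hmod hs, hmod ht]

lemma btw_lex {i' s' : ℕ} (hs : s < k) (hs' : s' < k) (ht : t < k) :
    Btw (i * k + s) (i' * k + s') (j * k + t) ↔
      (i < j ∨ i = j ∧ s ≤ t) ∧ (j < i' ∨ j = i' ∧ t < s') ∨
      (i' < j ∨ i' = j ∧ s' ≤ t) ∧ (j < i ∨ j = i ∧ t < s) := by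
  rw [Btw, lex_le hs ht, lex_lt ht hs', lex_le hs' ht, lex_lt ht hs]

lemma prodMap_lt (hV : BimodalModel N a b ν) (hU : UnimodalModel k κ μ) (rev : Bool) :
    ∀ x < N * k, prodMap k a b ν μ rev x < N * k := fun x hx => by
  obtain ⟨i, s, hs, rfl⟩ := exists_lex (Nat.zero_lt_of_lt hU.lt) x
  rw [prodMap_mk _ hs, lex_lt_mul (fiberMap_lt hU _ hs)]
  exact hV.maps i ((lex_lt_mul hs).1 hx)

lemma entry_prodMap_outer (hV : BimodalModel N a b ν) (hU : UnimodalModel k κ μ) (rev : Bool)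
    (hi : i + 1 < N) (ht : t < k) :
    entry (matOf (N * k) (prodMap k a b ν μ rev)) (i * k + (k - 1)) (j * k + t) =
      if Btw (ν i * k + fiberMap k μ rev (bsym a b i) (k - 1))
        (ν (i + 1) * k + fiberMap k μ rev (bsym a b (i + 1)) 0) (j * k + t) then 1 else 0 := by
  have h0 : 0 < k := by omega
  have hadd : i * k + (k - 1) + 1 = (i + 1) * k + 0 := by rw [Nat.add_mul]; omega
  rw [entry_matOf (prodMap_lt hV hU rev), hadd, prodMap_mk _ (by omega), prodMap_mk _ h0]
  simp only [lex_lt_mul h0, hi, true_and]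

lemma innerRow_eq (hV : BimodalModel N a b ν) (hU : UnimodalModel k κ μ)
    (hnext : π.next i = ν i) (hsym : π.sym i = bsym a b i) (hi : i < N) (hs : s + 1 < k)
    (ht : t < k) :
    (if t < k - 1 ∧ j = π.next i then innerBlock π (matOf k μ) i s t else 0) =
      entry (matOf (N * k) (prodMap k a b ν μ π.rev)) (i * k + s) (j * k + t) := by
  have hs' : s < k := by omega
  have hf := fiberMap_lt (rev := π.rev) hU (bsym a b i) hs
  have hf' := fiberMap_lt (rev := π.rev) hU (bsym a b i) hs'
  rw [entry_matOf (prodMap_lt hV hU π.rev), Nat.add_assoc, prodMap_mk _ hs', prodMap_mk _ hs,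
    hnext]
  simp only [btw_lex hf' hf ht, lex_lt_mul hs, hi, true_and]
  by_cases hc : t < k - 1 ∧ j = ν i
  · rw [if_pos hc, innerBlock_matOf hU hs (by omega), hsym]
    refine if_congr ?_ rfl rfl
    unfold Btw; omega
  · rw [if_neg hc, if_neg]
    omega

lemma outerRow_inner_eq (hV : BimodalModel N a b ν) (hU : UnimodalModel k κ μ) (hk : 2 ≤ k)
    (hnext : ∀ i < N, π.next i = ν i) (hsym : ∀ i < N, π.sym i = bsym a b i) (hi : i + 1 < N)
    (ht : t + 1 < k) :
    (if (if j = 0 then 0 else entry (matOf N ν) i (j - 1)) = entry (matOf N ν) i j then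
        (if j = 0 then 0 else entry (matOf N ν) i (j - 1))
      else if (j = π.next i ∧ contEntry π (matOf k μ) i true t) ∨
        (j = π.next (i + 1) ∧ contEntry π (matOf k μ) (i + 1) false t) then 1 else 0) =
      entry (matOf (N * k) (prodMap k a b ν μ π.rev)) (i * k + (k - 1)) (j * k + t) := by
  have hi' : i < N := by omega
  have hf := fiberMap_lt (rev := π.rev) hU (bsym a b i) (show k - 1 < k by omega)
  have hf' := fiberMap_lt (rev := π.rev) hU (bsym a b (i + 1)) (show 0 < k by omega)
  have hstep := hV.step i hi
  have hR := contEntry_right hV.ab hU hk (hsym i hi') ht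
  have hL := contEntry_left hV.ab hU hk (hsym _ hi) ht
  have hleft : i + 1 ≤ a ∨ b < i + 1 ↔ i < a ∨ b ≤ i := by omega
  simp only [ascending_bsym hV.ab] at hstep
  simp only [hleft] at hL
  have ht' : t < k := by omega
  rw [entry_prodMap_outer hV hU π.rev hi ht']
  simp only [btw_lex hf hf' ht', entry_matOf hV.maps, hi, true_and, hnext i hi', hnext _ hi, hR, hL]
  by_cases hj : j = ν i ∨ j = ν (i + 1)
  -- Exactly one of the two adjacent outer entries is `1`.
  · have hne : ¬(if j = 0 then 0 else if Btw (ν i) (ν (i + 1)) (j - 1) then 1 else 0) =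
        if Btw (ν i) (ν (i + 1)) j then 1 else 0 := fun h => by
      split_ifs at h hstep <;> unfold Btw at * <;> omega
    rw [if_neg hne]
    refine if_congr ?_ rfl rfl
    split_ifs at hstep ⊢ <;> omega
  · have heq : (if j = 0 then 0 else if Btw (ν i) (ν (i + 1)) (j - 1) then 1 else 0) =
        if Btw (ν i) (ν (i + 1)) j then 1 else 0 := by
      split_ifs <;> unfold Btw at * <;> omega
    rw [if_pos heq, heq]
    refine if_congr ?_ rfl rfl
    unfold Btw; omega

lemma outer_outer_eq (hV : BimodalModel N a b ν) (hU : UnimodalModel k κ μ) (rev : Bool)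
    (hi : i + 1 < N) : entry (matOf N ν) i j =
      entry (matOf (N * k) (prodMap k a b ν μ rev)) (i * k + (k - 1)) (j * k + (k - 1)) := by
  have h0 : 0 < k := Nat.zero_lt_of_lt hU.lt
  have h1 : k - 1 < k := by omega
  have hf := fiberMap_lt (rev := rev) hU (bsym a b i) h1
  have hf' := fiberMap_lt (rev := rev) hU (bsym a b (i + 1)) h0
  rw [entry_prodMap_outer hV hU rev hi h1, entry_matOf hV.maps]
  simp only [btw_lex hf hf' h1, hi, true_and]
  refine if_congr ?_ rfl rfl
  unfold Btw; omega

theorem blockProduct_matOf (hV : BimodalModel N a b ν) (hU : UnimodalModel k κ μ) (hk : 2 ≤ k)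
    (hnext : ∀ i < N, π.next i = ν i) (hsym : ∀ i < N, π.sym i = bsym a b i) :
    blockProduct (matOf N ν) π (matOf k μ) = matOf (N * k) (prodMap k a b ν μ π.rev) := by
  have hbN := hV.bN
  have hN : (matOf N ν).1 + 1 = N := by simp only [matOf]; omega
  have hB : (matOf k μ).1 + 1 = k := by simp only [matOf]; omega
  have hB' : (matOf k μ).1 = k - 1 := rfl
  have hsize : (blockProduct (matOf N ν) π (matOf k μ)).1 = N * k - 1 := by
    simp only [blockProduct, hN, hB]
  refine sqMat_ext hsize ?_
  rw [hsize]
  intro x hx y hy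
  obtain ⟨i, s, hs, rfl⟩ := exists_lex (k := k) (by omega) x
  obtain ⟨j, t, ht, rfl⟩ := exists_lex (k := k) (by omega) y
  have hentry := entry_blockProduct (π := π) (i := i) (s := s) (j := j) (t := t) (matOf N ν)
    (matOf k μ)
  rw [hN, hB, hB'] at hentry
  rw [hentry hs ht hx hy]
  by_cases hs' : s < k - 1
  · have hi : i < N := (lex_lt_mul hs).1 (by omega)
    rw [if_pos hs']
    exact innerRow_eq hV hU (hnext i hi) (hsym i hi) hi (by omega) ht
  · obtain rfl : s = k - 1 := by omega
    have hi : i + 1 < N := (lex_lt_mul (k := k) (s := 0) (by omega)).1 (by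
      rw [Nat.add_mul]; omega)
    rw [if_neg hs']
    by_cases ht' : t < k - 1
    · rw [if_pos ht']
      exact outerRow_inner_eq hV hU hk hnext hsym hi (by omega)
    · obtain rfl : t = k - 1 := by omega
      rw [if_neg ht']
      exact outer_outer_eq hV hU π.rev hi

end Block

/-! ### The second iterate of a unimodal model -/

/-- The increasing map whose image omits `q` only. -/
def skip (q i : ℕ) : ℕ := if i < q then i else i + 1

/-- The map `μ`, transported along `skip q` and extended to the new point `q` by the value of
`κ`. -/
def insertMap (q κ : ℕ) (μ : ℕ → ℕ) (x : ℕ) : ℕ :=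
  skip q (if x = q then κ else μ (if x < q then x else x - 1))

/-- Positions of the orbit of the turning point of a unimodal model together with both of its
preimages `α < γ`, one of which is not on the orbit: `τ` is the turning point, `g` the extended map
and `ι` maps the positions of the model to the new ones. -/
structure IsExtension (k κ : ℕ) (μ : ℕ → ℕ) (α τ γ : ℕ) (g ι : ℕ → ℕ) : Prop where
  left_lt : α < τ
  lt_right : τ < γ
  right_le : γ ≤ k
  mono : StrictMonoOn g (Set.Iic τ)
  anti : StrictAntiOn g (Set.Icc τ k)
  map_left : g α = τ
  map_right : g γ = τ
  map_ι : ∀ i < k, g (ι i) = ι (μ i)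
  usym_ι : ∀ i < k, usym τ (ι i) = usym κ i
  ι_le : ∀ i < k, ι i ≤ k
  cover : ∀ x ≤ k, x = α ∨ x = γ ∨ ∃ i < k, ι i = x

section Insert

variable {k q κ i x : ℕ} {μ : ℕ → ℕ}

lemma skip_of_lt (h : i < q) : skip q i = i := if_pos h

lemma skip_of_le (h : q ≤ i) : skip q i = i + 1 := if_neg h.not_gt

lemma skip_strictMono (q : ℕ) : StrictMono (skip q) := fun i j hij => by
  unfold skip; split_ifs <;> omega

lemma usym_skip (q κ i : ℕ) : usym (skip q κ) (skip q i) = usym κ i := by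
  simp only [usym, (skip_strictMono q).lt_iff_lt, (skip_strictMono q).injective.eq_iff]

lemma insertMap_self : insertMap q κ μ q = skip q κ := by rw [insertMap, if_pos rfl]

lemma insertMap_skip (q κ : ℕ) (μ : ℕ → ℕ) (i : ℕ) :
    insertMap q κ μ (skip q i) = skip q (μ i) := by
  unfold insertMap
  rcases Nat.lt_or_ge i q with h | h
  · rw [skip_of_lt h, if_neg h.ne, if_pos h]
  · rw [skip_of_le h, if_neg (by omega), if_neg (by omega), Nat.add_sub_cancel]

lemma insertMap_lt_succ (hlt : x + 1 < q → μ x < μ (x + 1)) (hpred : x + 1 = q → μ x < κ)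
    (heq : x = q → κ < μ x) (hgt : q < x → μ (x - 1) < μ x) :
    insertMap q κ μ x < insertMap q κ μ (x + 1) := by
  refine skip_strictMono q ?_
  grind

lemma insertMap_succ_lt (hlt : x + 1 < q → μ (x + 1) < μ x) (hpred : x + 1 = q → κ < μ x)
    (heq : x = q → μ x < κ) (hgt : q < x → μ x < μ (x - 1)) :
    insertMap q κ μ (x + 1) < insertMap q κ μ x := by
  refine skip_strictMono q ?_
  grind

lemma eq_or_exists_skip (hx : x ≤ k) (hq : q ≤ k) : x = q ∨ ∃ i < k, skip q i = x := by
  rcases lt_trichotomy x q with h | rfl | h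
  · exact .inr ⟨x, by omega, skip_of_lt h⟩
  · exact .inl rfl
  · exact .inr ⟨x - 1, by omega, by rw [skip_of_le (by omega)]; omega⟩

lemma skip_le (hi : i < k) : skip q i ≤ k := by unfold skip; split_ifs <;> omega

end Insert

namespace UnimodalModel

variable {k κ ρ : ℕ} {μ : ℕ → ℕ}

lemma injOn (h : UnimodalModel k κ μ) : Set.InjOn μ (Set.Iio k) := by
  have hinj := Finset.injOn_of_surjOn_of_card_le (s := .range k) (t := .range k) μ
    (fun i hi => by simpa using h.maps i (by simpa using hi))
    (fun y hy => by simpa using h.surj (by simpa using hy)) le_rfl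
  simpa using hinj

/-- If the preimage `ρ` of `κ` on the orbit is to the right of `κ`, then the new one is inserted on
the left, before the first point whose image exceeds `κ`. -/
lemma exists_extension_of_lt (h : UnimodalModel k κ μ) (hk : 2 ≤ k) (hρk : ρ < k) (hρ : μ ρ = κ)
    (hlt : κ < ρ) : ∃ α τ γ g ι, IsExtension k κ μ α τ γ g ι := by
  have hmax : κ < μ κ := by rw [h.map_turn]; exact h.turn_lt hk
  obtain ⟨q, hq, hmin⟩ : ∃ q, κ < μ q ∧ ∀ i < q, μ i ≤ κ := by
    classical
    have hex : ∃ i, κ < μ i := ⟨κ, hmax⟩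
    exact ⟨Nat.find hex, Nat.find_spec hex, fun i hi => not_lt.1 (Nat.find_min hex hi)⟩
  have hqκ : q ≤ κ := by
    by_contra! hκ
    exact absurd (hmin κ hκ) hmax.not_ge
  have below : ∀ i < q, μ i < κ := fun i hi => (hmin i hi).lt_of_ne fun heq => by
    have := h.injOn (Set.mem_Iio.2 (by omega)) (Set.mem_Iio.2 hρk) (heq.trans hρ.symm)
    omega
  have hτ : skip q κ = κ + 1 := skip_of_le hqκ
  refine ⟨q, skip q κ, skip q ρ, insertMap q κ μ, skip q, by omega, skip_strictMono q hlt,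
    skip_le hρk, ?_, ?_, insertMap_self, by rw [insertMap_skip, hρ],
    fun i _ => insertMap_skip q κ μ i, fun i _ => usym_skip q κ i, fun i hi => skip_le hi,
    fun x hx => (eq_or_exists_skip hx (by omega)).imp_right .inr⟩
  · refine strictMonoOn_of_lt_add_one Set.ordConnected_Iic fun x _ _ hx => ?_
    rw [Set.mem_Iic, hτ] at hx
    exact insertMap_lt_succ (fun _ => h.left (by omega) (by omega)) (fun _ => below x (by omega))
      (by rintro rfl; exact hq) (fun _ => h.left (by omega) (by omega))
  · refine strictAntiOn_of_add_one_lt Set.ordConnected_Icc fun x _ hx hx' => ?_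
    rw [Set.mem_Icc, hτ] at hx hx'
    exact insertMap_succ_lt (by omega) (by omega) (by omega)
      fun _ => h.right (by omega) (by omega) (by omega)

/-- If the preimage `ρ` of `κ` on the orbit is to the left of `κ`, then the new one is inserted on
the right, before the first point whose image is less than `κ`. -/
lemma exists_extension_of_gt (h : UnimodalModel k κ μ) (hk : 2 ≤ k) (hρ : μ ρ = κ)
    (hlt : ρ < κ) : ∃ α τ γ g ι, IsExtension k κ μ α τ γ g ι := by
  have hκ := h.turn_lt hk
  obtain ⟨q, ⟨hκq, hq⟩, hmin⟩ : ∃ q, (κ < q ∧ μ q < κ) ∧ ∀ i < q, κ < i → κ ≤ μ i := by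
    classical
    have hex : ∃ i, κ < i ∧ μ i < κ := ⟨k - 1, hκ, by rw [h.map_last hk]; omega⟩
    exact ⟨Nat.find hex, Nat.find_spec hex, fun i hi hκi =>
      not_lt.1 fun hlt => Nat.find_min hex hi ⟨hκi, hlt⟩⟩
  have hqk : q < k := by
    by_contra! hge
    have := hmin (k - 1) (by omega) hκ
    rw [h.map_last hk] at this
    omega
  have above : ∀ i < q, κ ≤ i → κ < μ i := fun i hi hκi => by
    rcases hκi.eq_or_lt with rfl | hκi
    · rwa [h.map_turn]
    · refine (hmin i hi hκi).lt_of_ne' fun heq => ?_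
      have := h.injOn (Set.mem_Iio.2 (by omega)) (Set.mem_Iio.2 (by omega)) (heq.trans hρ.symm)
      omega
  have hτ : skip q κ = κ := skip_of_lt hκq
  refine ⟨skip q ρ, skip q κ, q, insertMap q κ μ, skip q, skip_strictMono q hlt, by omega,
    hqk.le, ?_, ?_, by rw [insertMap_skip, hρ], insertMap_self,
    fun i _ => insertMap_skip q κ μ i, fun i _ => usym_skip q κ i, fun i hi => skip_le hi,
    fun x hx => .inr (eq_or_exists_skip hx hqk.le)⟩
  · refine strictMonoOn_of_lt_add_one Set.ordConnected_Iic fun x _ _ hx => ?_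
    rw [Set.mem_Iic, hτ] at hx
    exact insertMap_lt_succ (fun _ => h.left (by omega) hx) (by omega) (by omega) (by omega)
  · refine strictAntiOn_of_add_one_lt Set.ordConnected_Icc fun x _ hx hx' => ?_
    rw [Set.mem_Icc, hτ] at hx hx'
    exact insertMap_succ_lt (fun _ => h.right hx.1 (by omega) (by omega))
      (fun _ => above x (by omega) hx.1) (by rintro rfl; exact hq)
      (fun _ => h.right (by omega) (by omega) (by omega))

lemma exists_extension (h : UnimodalModel k κ μ) (hk : 2 ≤ k) :
    ∃ α τ γ g ι, IsExtension k κ μ α τ γ g ι := by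
  obtain ⟨ρ, hρk, hρ⟩ := h.surj h.lt
  rcases lt_trichotomy κ ρ with hlt | rfl | hlt
  · exact h.exists_extension_of_lt hk hρk hρ hlt
  · have := h.turn_lt hk
    have := h.map_turn
    omega
  · exact h.exists_extension_of_gt hk hρ hlt

end UnimodalModel

namespace IsExtension

variable {k κ α τ γ : ℕ} {μ g ι : ℕ → ℕ}

lemma map_le (h : IsExtension k κ μ α τ γ g ι) (hμ : ∀ i < k, μ i < k) {x : ℕ} (hx : x ≤ k) :
    g x ≤ k := by
  have := h.lt_right
  have := h.right_le
  rcases h.cover x hx with rfl | rfl | ⟨i, hi, rfl⟩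
  · rw [h.map_left]; omega
  · rw [h.map_right]; omega
  · rw [h.map_ι i hi]; exact h.ι_le _ (hμ i hi)

lemma le_map_of_le (h : IsExtension k κ μ α τ γ g ι) {x : ℕ} (hx : x ≤ τ) :
    τ ≤ g x ↔ α ≤ x := by
  rw [← h.map_left]
  exact h.mono.le_iff_le h.left_lt.le hx

lemma le_map_of_ge (h : IsExtension k κ μ α τ γ g ι) {x : ℕ} (hx : τ ≤ x) (hxk : x ≤ k) :
    τ ≤ g x ↔ x ≤ γ := by
  rw [← h.map_right]
  exact h.anti.le_iff_ge ⟨h.lt_right.le, h.right_le⟩ ⟨hx, hxk⟩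

lemma map_eq_iff (h : IsExtension k κ μ α τ γ g ι) {x : ℕ} (hxk : x ≤ k) :
    g x = τ ↔ x = α ∨ x = γ := by
  refine ⟨fun hx => ?_, by rintro (rfl | rfl); exacts [h.map_left, h.map_right]⟩
  rcases le_total x τ with hxτ | hxτ
  · exact .inl (h.mono.injOn hxτ h.left_lt.le (hx.trans h.map_left.symm))
  · exact .inr (h.anti.injOn ⟨hxτ, hxk⟩ ⟨h.lt_right.le, h.right_le⟩ (hx.trans h.map_right.symm))

lemma tsym_eq_pairCode (h : IsExtension k κ μ α τ γ g ι) {x : ℕ} (hxk : x ≤ k) :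
    tsym α τ γ x = pairCode (usym τ x) (usym τ (g x)) := by
  have := h.left_lt
  have := h.lt_right
  have heq := h.map_eq_iff hxk
  rcases lt_or_ge x τ with hx | hx
  · have hge := h.le_map_of_le hx.le
    unfold tsym bsym usym
    split_ifs <;> first | rfl | omega
  · have hge := h.le_map_of_ge hx hxk
    unfold tsym bsym usym
    split_ifs <;> first | rfl | omega

lemma ι_turn (h : IsExtension k κ μ α τ γ g ι) (hκ : κ < k) : ι κ = τ := by
  rw [← usym_eq_c, h.usym_ι κ hκ, usym_eq_c]

lemma iterate_ι (h : IsExtension k κ μ α τ γ g ι) (hμ : ∀ i < k, μ i < k) {i : ℕ} (hi : i < k)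
    (n : ℕ) : g^[n] (ι i) = ι (μ^[n] i) := by
  induction n with
  | zero => rfl
  | succ n ih =>
    rw [Function.iterate_succ_apply', ih, h.map_ι _ (iterate_lt hμ hi n),
      Function.iterate_succ_apply']

lemma step (h : IsExtension k κ μ α τ γ g ι) (hμ : ∀ i < k, μ i < k) {i : ℕ} (hi : i + 1 ≤ k) :
    if Ascending (tsym α τ γ i) then g (g i) < g (g (i + 1)) else g (g (i + 1)) < g (g i) := by
  have hατ := h.left_lt
  have hτγ := h.lt_right
  simp only [ascending_tsym hατ hτγ]
  have hk : ∀ x ≤ k, g x ≤ k := fun x => h.map_le hμ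
  rcases lt_or_ge i τ with hiτ | hiτ
  · have hlt : g i < g (i + 1) := h.mono hiτ.le hiτ (Nat.lt_add_one i)
    have hge := h.le_map_of_le hiτ.le
    have hge' := h.le_map_of_le (x := i + 1) hiτ
    have heq := h.map_eq_iff hi
    split_ifs with hasc
    · exact h.mono (by simp; omega) (by simp; omega) hlt
    · exact h.anti ⟨by omega, hk _ (by omega)⟩ ⟨by omega, hk _ hi⟩ hlt
  · have hlt : g (i + 1) < g i := h.anti ⟨hiτ, by omega⟩ ⟨by omega, hi⟩ (Nat.lt_add_one i)
    have hge := h.le_map_of_ge hiτ (by omega)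
    have hge' := h.le_map_of_ge (x := i + 1) (by omega) hi
    have heq := h.map_eq_iff (x := i) (by omega)
    split_ifs with hasc
    · exact h.anti ⟨by omega, hk _ hi⟩ ⟨by omega, hk _ (by omega)⟩ hlt
    · exact h.mono (by simp; omega) (by simp; omega) hlt

variable (h : IsExtension k κ μ α τ γ g ι) (hU : UnimodalModel k κ μ)
include h hU

lemma sq_lt {x : ℕ} (hx : x < k + 1) : (g^[2]) x < k + 1 := by
  have hg := fun {x} => h.map_le hU.maps (x := x)
  exact Nat.lt_succ_of_le (hg (hg (Nat.le_of_lt_succ hx)))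

lemma exists_iterate_sq_turn {x : ℕ} (hx : x < k + 1) :
    ∃ n, eps (tsym α τ γ ((g^[2])^[n] x)) = 0 := by
  simp only [eps_tsym h.left_lt h.lt_right]
  rcases h.cover x (by omega) with rfl | rfl | ⟨i, hi, rfl⟩
  · exact ⟨0, .inl rfl⟩
  · exact ⟨0, .inr (.inr rfl)⟩
  obtain ⟨m, hm⟩ := hU.exists_iterate_turn hi
  have hτ : g^[m] (ι i) = τ := by rw [h.iterate_ι hU.maps hi, hm, h.ι_turn hU.lt]
  rcases Nat.even_or_odd' m with ⟨n, rfl | rfl⟩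
  · exact ⟨n, .inr (.inl (by rwa [← Function.iterate_mul]))⟩
  · rw [Function.iterate_succ_apply', h.map_eq_iff, Function.iterate_mul] at hτ
    · exact ⟨n, hτ.imp_right .inr⟩
    · rw [h.iterate_ι hU.maps hi]
      exact h.ι_le _ (iterate_lt hU.maps hi _)

lemma exists_turn_iterate_sq {x : ℕ} (hx : x < k + 1) :
    ∃ t < k + 1, eps (tsym α τ γ t) = 0 ∧ ∃ n, (g^[2])^[n] t = x := by
  have hατ := h.left_lt
  have hτγ := h.lt_right
  have hγ := h.right_le
  simp only [eps_tsym hατ hτγ]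
  rcases h.cover x (by omega) with rfl | rfl | ⟨i, hi, rfl⟩
  · exact ⟨x, hx, .inl rfl, 0, rfl⟩
  · exact ⟨x, hx, .inr (.inr rfl), 0, rfl⟩
  obtain ⟨m, rfl⟩ := hU.exists_iterate_eq hi
  rw [← h.iterate_ι hU.maps hU.lt, h.ι_turn hU.lt]
  rcases Nat.even_or_odd' m with ⟨n, rfl | rfl⟩
  · exact ⟨τ, by omega, .inr (.inl rfl), n, by rw [← Function.iterate_mul]⟩
  · refine ⟨α, by omega, .inl rfl, n + 1, ?_⟩
    rw [← Function.iterate_mul, show 2 * (n + 1) = 2 * n + 1 + 1 by ring,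
      Function.iterate_succ_apply, h.map_left]

lemma trimodalModel : TrimodalModel (k + 1) α τ γ (g^[2]) where
  maps _ := h.sq_lt hU
  step _ hi := h.step hU.maps (by omega)
  mono i _ := tsym_mono h.lt_right i
  turn _ := h.exists_iterate_sq_turn hU
  cover _ := h.exists_turn_iterate_sq hU
  ab := h.left_lt
  bc := h.lt_right
  cN := Nat.lt_succ_of_le h.right_le
  top := congrArg g (h.map_left.trans h.map_right.symm)

lemma itin_sq_ι {i : ℕ} (hi : i < k) (n : ℕ) : itin (g^[2]) (tsym α τ γ) (ι i) n =
    pairCode (usym κ (μ^[2 * n] i)) (usym κ (μ^[2 * n + 1] i)) := by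
  have hlt := iterate_lt hU.maps hi
  rw [itin, ← Function.iterate_mul, h.iterate_ι hU.maps hi, h.tsym_eq_pairCode (h.ι_le _ (hlt _)),
    h.map_ι _ (hlt _), ← Function.iterate_succ_apply' μ, h.usym_ι _ (hlt _), h.usym_ι _ (hlt _)]

lemma right_lt (hk : 3 ≤ k) : γ < k := by
  have hpos := hU.turn_pos hk
  have hlast := hU.turn_lt (by omega)
  have hr : τ < ι (k - 1) := usym_eq_r.1 (by rw [h.usym_ι _ (by omega), usym_eq_r.2 hlast])
  have hl : ι 0 < τ := ascending_usym.1 (by rw [h.usym_ι _ (by omega), ascending_usym]; exact hpos)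
  have hιk := h.ι_le (k - 1) (by omega)
  have hge := h.le_map_of_ge hr.le hιk
  rw [h.map_ι _ (by omega), hU.map_last (by omega)] at hge
  omega

end IsExtension

/-- `ν` models the trimodal second iterate of a unimodal map whose turning point has the periodic
kneading sequence `X^∞` and the model `μ`. -/
structure IsTModel (X : List USym) (κ : ℕ) (μ : ℕ → ℕ) (a b c : ℕ) (ν : ℕ → ℕ) : Prop
    extends TrimodalModel (X.length + 1) a b c ν where
  itin_outer : ∀ n, itin ν (tsym a b c) (ν a) n =
    pairCode (usym κ (μ^[2 * n + 1] κ)) (usym κ (μ^[2 * n + 2] κ))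
  itin_middle : ∀ n, itin ν (tsym a b c) (ν b) n =
    pairCode (usym κ (μ^[2 * n + 2] κ)) (usym κ (μ^[2 * n + 3] κ))
  outer_lt : 3 ≤ X.length → c < X.length
  hits : Odd X.length → ∃ n, ν^[n] a = b

lemma IsUModel.exists_trimodal {X : List USym} {κ : ℕ} {μ : ℕ → ℕ} (hX : IsUModel X κ μ) :
    ∃ a b c ν, IsTModel X κ μ a b c ν := by
  obtain ⟨α, τ, γ, g, ι, h⟩ := hX.exists_extension hX.two_le
  have hU := hX.toUnimodalModel
  have hτ : ι κ = τ := h.ι_turn hU.lt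
  refine ⟨α, τ, γ, g^[2], h.trimodalModel hU, fun n => ?_, fun n => ?_, h.right_lt hU,
    fun hodd => ?_⟩
  · rw [show (g^[2]) α = ι (μ κ) by rw [← h.map_ι κ hU.lt, hτ, ← h.map_left]; rfl,
      h.itin_sq_ι hU (hU.maps κ hU.lt)]
    rfl
  · rw [show (g^[2]) τ = ι (μ (μ κ)) by
      rw [← h.map_ι _ (hU.maps κ hU.lt), ← h.map_ι κ hU.lt, hτ]; rfl,
      h.itin_sq_ι hU (hU.maps _ (hU.maps κ hU.lt))]
    rfl
  · obtain ⟨n, hn⟩ := hodd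
    refine ⟨n + 1, ?_⟩
    rw [← Function.iterate_mul, show 2 * (n + 1) = X.length + 1 by omega,
      Function.iterate_succ_apply, h.map_left, ← hτ, h.iterate_ι hU.maps hU.lt, hX.period]

/-! ### Factors are determined by their matrices -/

section Uniqueness

lemma IsModel.ascending_congr {α : Type} [LapAlphabet α] {N : ℕ} {ν ν' : ℕ → ℕ} {sy sy' : ℕ → α}
    (h : IsModel N ν sy) (h' : IsModel N ν' sy') (heq : ∀ i < N, ν i = ν' i) {i : ℕ}
    (hi : i + 1 < N) : Ascending (sy i) ↔ Ascending (sy' i) := by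
  have hstep := h.step i hi
  have hstep' := h'.step i hi
  rw [heq i (by omega), heq (i + 1) hi] at hstep
  by_cases hasc : Ascending (sy i) <;> by_cases hasc' : Ascending (sy' i) <;>
    simp only [hasc, hasc', if_true, if_false] at hstep hstep' ⊢ <;> omega

variable {N a b c a' b' c' : ℕ} {ν ν' : ℕ → ℕ}

lemma BimodalModel.unique (h : BimodalModel N a b ν) (h' : BimodalModel N a' b' ν')
    (hb : b + 1 < N) (hb' : b' + 1 < N) (heq : matOf N ν = matOf N ν') :
    (∀ i < N, ν i = ν' i) ∧ a = a' ∧ b = b' := by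
  have hab := h.ab
  have hab' := h'.ab
  have hν := h.eqOn_of_matOf_eq h'.toIsModel (by omega) heq
    (by rw [ascending_bsym hab, ascending_bsym hab']; omega)
  have hasc : ∀ i, i + 1 < N → (i < a ∨ b ≤ i ↔ i < a' ∨ b' ≤ i) := fun i hi => by
    rw [← ascending_bsym hab, ← ascending_bsym hab']
    exact h.ascending_congr h'.toIsModel hν hi
  have := hasc a (by omega)
  have := hasc a' (by omega)
  have := hasc b hb
  have := hasc b' hb'
  exact ⟨hν, by omega, by omega⟩

lemma TrimodalModel.unique (h : TrimodalModel N a b c ν) (h' : TrimodalModel N a' b' c' ν')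
    (hc : c + 1 < N) (hc' : c' + 1 < N) (heq : matOf N ν = matOf N ν') :
    (∀ i < N, ν i = ν' i) ∧ a = a' ∧ b = b' ∧ c = c' := by
  obtain ⟨hab, hbc⟩ := And.intro h.ab h.bc
  obtain ⟨hab', hbc'⟩ := And.intro h'.ab h'.bc
  have hν := h.eqOn_of_matOf_eq h'.toIsModel (by omega) heq
    (by rw [ascending_tsym hab hbc, ascending_tsym hab' hbc']; omega)
  have hasc : ∀ i, i + 1 < N → (i < a ∨ b ≤ i ∧ i < c ↔ i < a' ∨ b' ≤ i ∧ i < c') :=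
    fun i hi => by
      rw [← ascending_tsym hab hbc, ← ascending_tsym hab' hbc']
      exact h.ascending_congr h'.toIsModel hν hi
  have := hasc a (by omega)
  have := hasc a' (by omega)
  have := hasc b (by omega)
  have := hasc b' (by omega)
  have := hasc c hc
  have := hasc c' hc'
  exact ⟨hν, by omega, by omega, by omega⟩

end Uniqueness

section SecondFactors

variable {X X' : List USym} {κ κ' a b c n : ℕ} {μ μ' ν : ℕ → ℕ} {W W' : Factor}

lemma periodic_map_range {α : Type} (d : α) {h : ℕ → α} (hn : 0 < n)
    (hper : Function.Periodic h n) : periodic d ((List.range n).map h) = h := by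
  funext m
  have hm : m % n < ((List.range n).map h).length := by simpa using Nat.mod_lt m hn
  rw [periodic, List.length_map, List.length_range, List.getD_eq_getElem _ _ hm]
  simp [hper.map_mod_nat]

namespace IsUModel

lemma markovU_eq (hX : IsUModel X κ μ) : markovU X = matOf X.length μ :=
  hX.markov_eq hX.itin_eq

lemma eq_of_length_eq_two (hX : IsUModel X κ μ) (h2 : X.length = 2) : X = [.r, .c] := by
  have hperiod := hX.period
  rw [h2] at hperiod
  have hr := hX.usym_succ_of_eq_c (n := 0) (usym_eq_c.2 rfl)
  rw [hX.eq_map_range, h2]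
  simp only [List.range_succ, List.range_zero, List.nil_append, List.cons_append, List.map_cons,
    List.map_nil, hr, hperiod, usym_eq_c.2]

lemma eq_of_forall_usym_eq (hX : IsUModel X κ μ) (hX' : IsUModel X' κ' μ')
    (hlen : X.length = X'.length)
    (h : ∀ n, usym κ (μ^[n + 1] κ) = usym κ' (μ'^[n + 1] κ')) : X = X' := by
  rw [hX.eq_map_range, hX'.eq_map_range, hlen]
  exact List.map_congr_left fun n _ => h n

end IsUModel

namespace IsTModel

lemma periodic_itin_outer (hT : IsTModel X κ μ a b c ν) (hX : IsUModel X κ μ)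
    (hn : X.length ∣ 2 * n) : Function.Periodic (itin ν (tsym a b c) (ν a)) n := fun i => by
  simp only [hT.itin_outer, hX.iterate_add_double hn]

lemma periodic_itin_middle (hT : IsTModel X κ μ a b c ν) (hX : IsUModel X κ μ)
    (hn : X.length ∣ 2 * n) : Function.Periodic (itin ν (tsym a b c) (ν b)) n := fun i => by
  simp only [hT.itin_middle, hX.iterate_add_double hn]

lemma markovW_minus (hT : IsTModel X κ μ a b c ν) (hX : IsUModel X κ μ) (hodd : Odd X.length) :
    (Factor.minus (translate (X ++ X))).markovW = .inr (matOf (X.length + 1) ν) := by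
  have hK : periodic .A (translate (X ++ X)) = itin ν (tsym a b c) (ν a) := by
    simp only [hX.translate_append_self, ← hT.itin_outer]
    exact periodic_map_range .A hodd.pos (hT.periodic_itin_outer hX (dvd_mul_left _ _))
  have hA : consSeq .A (periodic .A (translate (X ++ X))) = itin ν (tsym a b c) a := by
    rw [hK, itin_eq_consSeq ν _ a, (tsym_eq_A hT.ab).2 rfl]
  exact congrArg Sum.inr (hT.markov_eq hK
    (itin_idxOf hT.ab.ne (fun _ => tsym_eq_B) hA (hT.hits hodd)))

lemma markovW_plus (hT : IsTModel X κ μ a b c ν) (hX : IsUModel X κ μ) (heven : Even X.length) :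
    (Factor.plus (translate X) (translate (X.rotate 1))).markovW =
      .inr (matOf (X.length + 1) ν) := by
  obtain ⟨n, hn⟩ := even_iff_exists_two_mul.1 heven
  have hdvd : X.length ∣ 2 * n := dvd_of_eq hn
  have hpos : 0 < n := by have := hX.two_le; omega
  refine congrArg Sum.inr (hT.markov_eq ?_ ?_)
  · simp only [hX.translate_even hn, ← hT.itin_outer]
    exact periodic_map_range .A hpos (hT.periodic_itin_outer hX hdvd)
  · rw [itin_eq_consSeq ν _ b, tsym_eq_B.2 rfl]
    simp only [hX.translate_rotate hn, ← hT.itin_middle]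
    exact congrArg _ (periodic_map_range .B hpos (hT.periodic_itin_middle hX hdvd))

end IsTModel

lemma Factor.Over.eq_twin_or_markovW_eq (hW : W.Over X) (hX : IsUModel X κ μ)
    (hT : IsTModel X κ μ a b c ν) :
    W = .twin X ∨ W.markovW = .inr (matOf (X.length + 1) ν) := by
  cases hW with
  | twin => exact .inl rfl
  | minus hodd => exact .inr (hT.markovW_minus hX hodd)
  | plus heven => exact .inr (hT.markovW_plus hX heven)

lemma Factor.Over.k_eq (hW : W.Over X) (hX : IsUModel X κ μ) : W.k = X.length := by
  cases hW with
  | twin => rfl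
  | minus _ => simp [Factor.k, hX.translate_append_self]
  | plus heven =>
    obtain ⟨n, hn⟩ := even_iff_exists_two_mul.1 heven
    simp [Factor.k, hX.translate_even hn, hX.translate_rotate hn, hn, two_mul]

lemma pairCode_inj {x y x' y' : USym} (hx : x = .c → y = .r) (hx' : x' = .c → y' = .r)
    (h : pairCode x y = pairCode x' y') : x = x' ∧ y = y' := by
  cases x <;> cases y <;> cases x' <;> cases y' <;> simp_all [pairCode]

lemma IsTModel.eq_of_matOf_eq {a' b' c' : ℕ} {ν' : ℕ → ℕ} (hT : IsTModel X κ μ a b c ν)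
    (hT' : IsTModel X' κ' μ' a' b' c' ν') (hX : IsUModel X κ μ) (hX' : IsUModel X' κ' μ')
    (heq : matOf (X.length + 1) ν = matOf (X'.length + 1) ν') : X = X' := by
  have hlen : X.length = X'.length :=
    Nat.succ_injective (matOf_size_eq (Nat.succ_pos _) (Nat.succ_pos _) heq)
  rcases hX.two_le.eq_or_lt with h2 | h3
  · rw [hX.eq_of_length_eq_two h2.symm, hX'.eq_of_length_eq_two (hlen ▸ h2.symm)]
  rw [← hlen] at heq
  have hmodel' := hT'.toTrimodalModel
  have hc' := hT'.outer_lt (hlen ▸ h3)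
  rw [← hlen] at hmodel' hc'
  obtain ⟨hν, rfl, rfl, rfl⟩ := hT.toTrimodalModel.unique hmodel'
    (Nat.succ_lt_succ (hT.outer_lt h3)) (Nat.succ_lt_succ hc') heq
  have ha : a < X.length + 1 := hT.ab.trans (hT.bc.trans hT.cN)
  have houter : ∀ n, usym κ (μ^[2 * n + 1] κ) = usym κ' (μ'^[2 * n + 1] κ') ∧
      usym κ (μ^[2 * n + 2] κ) = usym κ' (μ'^[2 * n + 2] κ') := fun n => by
    refine pairCode_inj hX.usym_succ_of_eq_c hX'.usym_succ_of_eq_c ?_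
    rw [← hT.itin_outer, ← hT'.itin_outer, ← hν a ha, itin_congr hT.maps hν _ (hT.maps a ha)]
  refine hX.eq_of_forall_usym_eq hX' hlen fun n => ?_
  rcases Nat.even_or_odd' n with ⟨m, rfl | rfl⟩
  · exact (houter m).1
  · exact (houter m).2

lemma markovU_eq_of_markovW_eq (hX : IsUModel X κ μ) (hX' : IsUModel X' κ' μ') (hW : W.Over X)
    (hW' : W'.Over X') (h : W.markovW = W'.markovW) : markovU X = markovU X' := by
  obtain ⟨a, b, c, ν, hT⟩ := hX.exists_trimodal
  obtain ⟨a', b', c', ν', hT'⟩ := hX'.exists_trimodal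
  rcases hW.eq_twin_or_markovW_eq hX hT with rfl | hM <;>
    rcases hW'.eq_twin_or_markovW_eq hX' hT' with rfl | hM'
  · exact congrArg Prod.fst (Sum.inl_injective h)
  · exact absurd (h.trans hM') Sum.inl_ne_inr
  · exact absurd (hM.symm.trans h) Sum.inr_ne_inl
  · rw [hT.eq_of_matOf_eq hT' hX hX' (Sum.inr_injective (hM.symm.trans (h.trans hM')))]

end SecondFactors

section FirstFactors

lemma SymData.ext_isDoubly_word {V V' : SymData} (h : V.isDoubly = V'.isDoubly)
    (hword : V.word = V'.word) : V = V' := by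
  cases V <;> cases V' <;> simp_all [isDoubly, word]

lemma SymData.LapWord.eq_of_seq_eq {V V' : SymData} (hV : V.LapWord) (hV' : V'.LapWord)
    (hlen : V.word.length = V'.word.length) (hseq : V.seq false = V'.seq false) : V = V' := by
  refine ext_isDoubly_word ?_ (List.ext_getElem hlen fun n hn hn' => ?_)
  · have hend := hV.seq_length false
    rw [hseq, hlen, hV'.seq_length] at hend
    revert hend
    cases V.isDoubly <;> cases V'.isDoubly <;> decide
  · exact (hV.seq_of_lt false hn).symm.trans ((congrFun hseq n).trans (hV'.seq_of_lt false hn'))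

namespace IsBModel

variable {V V' : SymData} {a b a' b' i : ℕ} {ν ν' : ℕ → ℕ}

lemma markovV_eq (hV : IsBModel V a b ν) : V.markovV = matOf (2 * V.p) ν :=
  hV.markov_eq (hV.itin_turn false) (hV.itin_turn true)

/-- Conjugation carries an iterate of a turning point in the first lap to one in the last lap. -/
lemma exists_turn_lt (hV : IsBModel V a b ν) (hi : i < a) : ∃ j < 2 * V.p, b < j := by
  have hab := hV.ab
  have hN := hV.bN
  obtain ⟨x, -, hx, n, hn⟩ := hV.cover i (by omega)
  obtain ⟨t, rfl⟩ := (eps_bsym_eq_zero hab).1 hx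
  cases n with
  | zero => cases t <;> simp only [Function.iterate_zero_apply, turnPos] at hn <;> grind
  | succ n =>
    have hL : V.seq t n = .L := by
      rw [← hV.itin_image t, itin, ← Function.iterate_succ_apply, hn, bsym_eq_L.2 hi]
    refine ⟨ν^[n + 1] (turnPos a b (!t)),
      iterate_lt hV.maps (turnPos_lt hV.toBimodalModel _) _, (bsym_eq_R hab).1 ?_⟩
    have hR := hV.lapWord.seq_not t n
    rwa [← hV.itin_image, hL] at hR

lemma turn_lt (hV : IsBModel V a b ν) (hpos : 0 < V.word.length) : b + 1 < 2 * V.p := by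
  have hab := hV.ab
  have hN := hV.bN
  by_contra! hb
  have ha : a = 0 := by
    by_contra! ha
    obtain ⟨j, hj, hbj⟩ := hV.exists_turn_lt (Nat.pos_of_ne_zero ha)
    omega
  have hdesc : ∀ i ≤ b, i + ν i ≤ ν a := by
    intro i
    induction i with
    | zero => rw [ha]; omega
    | succ i ih =>
      intro hi
      have hstep := hV.step i (by omega)
      rw [if_neg (by rw [ascending_bsym hab]; omega)] at hstep
      have := ih (by omega)
      omega
  have hνa : ν a = b := by
    have := hdesc b le_rfl
    have := hV.maps a (by omega)
    omega
  refine hV.lapWord.seq_ne_turnSym false true hpos ?_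
  rw [← hV.itin_image false]
  exact (bsym_eq_B hab).2 hνa

lemma isDoubly_of_length_eq_zero (hV : IsBModel V a b ν) (h0 : V.word.length = 0) :
    V.isDoubly = true := by
  by_contra hpair
  rw [Bool.not_eq_true] at hpair
  have hp : V.p = 1 := by rw [SymData.p, h0]
  have hfix := hV.iterate_p
  rw [hp] at hfix
  simp only [hpair, Bool.xor_false, Function.iterate_one] at hfix
  have hlt := hV.lt_of_not_ascending hV.ab hV.bN fun n hn hn' => by
    rw [ascending_bsym hV.ab]; omega
  exact hlt.not_gt ((hfix false).trans_lt (hV.ab.trans_eq (hfix true).symm))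

lemma unique (hV : IsBModel V a b ν) (hV' : IsBModel V' a' b' ν') (h : V.markovV = V'.markovV) :
    V = V' := by
  rw [hV.markovV_eq, hV'.markovV_eq] at h
  have hsize := matOf_size_eq (Nat.zero_lt_of_lt hV.bN) (Nat.zero_lt_of_lt hV'.bN) h
  have hlen : V.word.length = V'.word.length := by
    simp only [SymData.p] at hsize; omega
  rcases Nat.eq_zero_or_pos V.word.length with h0 | hpos
  · refine SymData.ext_isDoubly_word ?_ ?_
    · rw [hV.isDoubly_of_length_eq_zero h0, hV'.isDoubly_of_length_eq_zero (hlen ▸ h0)]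
    · rw [List.length_eq_zero_iff.1 h0, List.length_eq_zero_iff.1 (hlen.symm.trans h0)]
  have hmodel' := hV'.toBimodalModel
  have hb' := hV'.turn_lt (hlen ▸ hpos)
  rw [← hsize] at h hmodel' hb'
  obtain ⟨hν, rfl, rfl⟩ := hV.toBimodalModel.unique hmodel' (hV.turn_lt hpos) hb' h
  refine hV.lapWord.eq_of_seq_eq hV'.lapWord hlen ?_
  have ha : turnPos a b false < 2 * V.p := turnPos_lt hV.toBimodalModel false
  rw [← hV.itin_image, ← hV'.itin_image, ← hν _ ha, itin_congr hV.maps hν _ (hV.maps _ ha)]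

end IsBModel

end FirstFactors

/-! ### The product -/

section Product

variable {V : SymData} {X : List USym} {a b : ℕ} {ν : ℕ → ℕ} {W : Factor}

lemma IsBModel.isPattern (hV : IsBModel V a b ν) : V.IsPattern ⟨ν, bsym a b, V.rev⟩ := by
  have hT : ∀ t, t ∈ [a, b] ↔ t < 2 * V.p ∧ eps (bsym a b t) = 0 := fun t => by
    have := hV.ab
    have := hV.bN
    rw [eps_bsym hV.ab]
    simp only [List.mem_cons, List.not_mem_nil, or_false]
    omega
  have hdata : [(Sym.A, V.blocks.seqA), (Sym.B, V.blocks.seqB)] =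
      kneading ν (bsym a b) [a, b] := by
    simp only [kneading, List.map_cons, List.map_nil, bsym_eq_A.2, (bsym_eq_B hV.ab).2]
    rw [show itin ν (bsym a b) (ν a) = V.blocks.seqA from hV.itin_image false,
      show itin ν (bsym a b) (ν b) = V.blocks.seqB from hV.itin_image true]
  constructor
  · rw [hdata, hV.points_kneading hT]
    rintro _ ⟨i, hi, rfl⟩
    rw [shift_itin, hV.pos_itin hT hi, hV.pos_itin hT (hV.maps i hi)]
    exact ⟨rfl, rfl⟩
  · cases V with
    | pair P => exact Bool.xor_false _
    | doubly P => exact rev_doubly P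

open Classical in
/-- The block pattern of symmetric data with the given transition matrix; junk if there is none. -/
noncomputable def patternOf (A : SqMat) : BlockPattern :=
  if h : ∃ (π : BlockPattern) (V : SymData) (a b : ℕ) (ν : ℕ → ℕ), IsBModel V a b ν ∧
      V.markovV = A ∧ π = ⟨ν, bsym a b, V.rev⟩ then h.choose else ⟨id, fun _ => .M, false⟩

open Classical in
/-- The unimodal matrix behind the matrix of a second factor; junk for other matrices. -/
noncomputable def coreOf (B : FactorMat) : SqMat :=
  if h : ∃ X, IsUnimodalWord X ∧ ∃ W : Factor, W.Over X ∧ W.markovW = B then markovU h.choose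
  else ⟨0, 0⟩

lemma patternOf_markovV (hV : V.InD) :
    ∃ a b ν, IsBModel V a b ν ∧ patternOf V.markovV = ⟨ν, bsym a b, V.rev⟩ := by
  obtain ⟨a, b, ν, hM⟩ := hV.exists_model
  have h : ∃ (π : BlockPattern) (V' : SymData) (a b : ℕ) (ν : ℕ → ℕ), IsBModel V' a b ν ∧
      V'.markovV = V.markovV ∧ π = ⟨ν, bsym a b, V'.rev⟩ := ⟨_, V, a, b, ν, hM, rfl, rfl⟩
  rw [patternOf, dif_pos h]
  obtain ⟨V', a', b', ν', hM', heq, hπ⟩ := h.choose_spec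
  obtain rfl : V' = V := hM'.unique hM heq
  exact ⟨a', b', ν', hM', hπ⟩

lemma coreOf_markovW (hX : IsUnimodalWord X) (hW : W.Over X) : coreOf W.markovW = markovU X := by
  have h : ∃ X', IsUnimodalWord X' ∧ ∃ W' : Factor, W'.Over X' ∧ W'.markovW = W.markovW :=
    ⟨X, hX, W, hW, rfl⟩
  rw [coreOf, dif_pos h]
  obtain ⟨hX', W', hW', heq⟩ := h.choose_spec
  obtain ⟨κ, μ, hM⟩ := hX.exists_model
  obtain ⟨κ', μ', hM'⟩ := hX'.exists_model
  exact markovU_eq_of_markovW_eq hM' hM hW' hW heq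

end Product

end SymBimodal

open SymBimodal in
theorem theorem2 :
    ∃ (otimes : SqMat → FactorMat → SqMat)
      (pattern : SqMat → BlockPattern) (core : FactorMat → SqMat),
      -- the product is the block matrix with pattern read off `A` and inner blocks read off `B`
      (∀ A B, otimes A B = blockProduct A (pattern A) (core B)) ∧
      -- the pattern of `A_V` is the block pattern of `V`
      (∀ V : SymData, V.InD → V.IsPattern (pattern V.markovV) ∧ V.markovV.1 = 2 * V.p - 1) ∧
      -- the inner blocks are given by the unimodal matrix behind `A_W`
      (∀ X, IsUnimodalWord X → ∀ W : Factor, W.Over X →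
        core W.markovW = markovU X ∧ (markovU X).1 = W.k - 1) ∧
      -- `A_{V ⋆ W} = A_V ⊗ A_W`, of size `2 p k - 1`
      (∀ V : SymData, V.InD → ∀ X, IsUnimodalWord X → ∀ W : Factor, W.Over X →
        ∀ S, star V W = some S →
          S.markovB = otimes V.markovV W.markovW ∧ S.markovB.1 = 2 * V.p * W.k - 1) := by
  refine ⟨fun A B => blockProduct A (patternOf A) (coreOf B), patternOf, coreOf, fun _ _ => rfl,
    fun V hV => ?_, fun X hX W hW => ?_, fun V hV X hX W hW S hS => ?_⟩
  · obtain ⟨a, b, ν, hM, hπ⟩ := patternOf_markovV hV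
    exact ⟨hπ ▸ hM.isPattern, congrArg Sigma.fst hM.markovV_eq⟩
  · obtain ⟨κ, μ, hM⟩ := hX.exists_model
    exact ⟨coreOf_markovW hX hW, hW.k_eq hM ▸ congrArg Sigma.fst hM.markovU_eq⟩
  · obtain ⟨a, b, ν, hM, hπ⟩ := patternOf_markovV hV
    obtain ⟨κ, μ, hU⟩ := hX.exists_model
    have hstar := markovB_star hM hU hW hS
    constructor
    · beta_reduce
      rw [hstar, hπ, coreOf_markovW hX hW, hM.markovV_eq, hU.markovU_eq]
      exact (blockProduct_matOf (π := ⟨ν, bsym a b, V.rev⟩) hM.toBimodalModel hU.toUnimodalModel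
        hU.two_le (fun _ _ => rfl) fun _ _ => rfl).symm
    · rw [hW.k_eq hU]
      exact congrArg Sigma.fst hstar
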